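/- Let $n,m\ge 1$, $A\in\mathbb R^{n\times n}$, $B\in\mathbb R^{n\times m}$, and let $Q,\Omega\in\mathbb R^{n\times n}$ and $R\in\mathbb R^{m\times m}$ be symmetric positive definite. Let $\mathcal S_K$ be the set of $K\in\mathbb R^{m\times n}$ such that $A-BK$ is Hurwitz. For $K\in\mathcal S_K$ put $$X(K)=\int_0^\infty e^{(A-BK)t}\,\Omega\,e^{(A-BK)^Tt}\,dt,\qquad f(K)=\operatorname{trace}\big((Q+K^TRK)X(K)\big),$$ and let $f(K)=+\infty$ for $K\notin\mathcal S_K$. Let $\|\cdot\|_F$ be the Frobenius norm, $\|\cdot\|_2$ the largest singular value of a matrix, $\lambda_{\min}$ the smallest eigenvalue, and $\nabla f$ the gradient with respect to $\langle X,Y\rangle=\operatorname{trace}(X^TY)$. Let $\mathcal A(X)=AX+XA^T$ on the symmetric $n\times n$ matrices and $\mathcal B(Y)=BY+Y^TB^T$ from $\mathbb R^{m\times n}$ to the symmetric matrices; $\|\mathcal B\|_2$ and, when $\mathcal A$ is invertible, $\|\mathcal A^{-1}\|_2$ denote operator norms with respect to Frobenius norms. For $a>0$ set $$\nu=\frac{\lambda_{\min}^2(\Omega)}{4}\Big(\frac{\|A\|_2}{\sqrt{\lambda_{\min}(Q)}}+\frac{\|B\|_2}{\sqrt{\lambda_{\min}(R)}}\Big)^{-2},\qquad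 \eta=\frac{\|\mathcal B\|_2}{\lambda_{\min}(Q)\lambda_{\min}(\Omega)\sqrt{\nu\lambda_{\min}(R)}},$$ $$\mu=\frac{2\lambda_{\min}(R)\lambda_{\min}(Q)}{a(1+a^2\eta)^2},\qquad c=\frac{\nu\sqrt{\nu\lambda_{\min}(R)}}{2a^2\|\mathcal A^{-1}\|_2\|B\|_2+a\sqrt{\nu\lambda_{\min}(R)}},\qquad b=\frac{a^2\|R\|_2}{\nu\,\lambda_{\min}(R)\lambda_{\min}(Q)}.$$ Theorem. Let $K(0)\in\mathcal S_K$. Then $f$ has a unique global minimizer $K^\star$, the gradient flow $\dot K=-\nabla f(K)$ started at $K(0)$ has a unique solution $K:[0,\infty)\to\mathcal S_K$, and for every real $a\ge f(K(0))$ (for instance $a=f(K(0))$) there is a $\rho>0$, depending only on $K(0)$, $a$ and the problem parameters, such that for all $t\ge 0$ $$f(K(t))-f(K^\star)\le e^{-\rho t}\big(f(K(0))-f(K^\star)\big),\qquad \|K(t)-K^\star\|_F^2\le b\,e^{-\rho t}\,\|K(0)-K^\star\|_F^2 .$$ If the linear map $\mathcal A$ is invertible, this holds with $\rho=2\mu c^2$.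 -/

import Mathlib

open scoped Matrix Matrix.Norms.Frobenius

noncomputable section

namespace LQR

/-- A real square matrix is Hurwitz if all its complex eigenvalues have negative real part. -/
def IsHurwitz {n : ℕ} (F : Matrix (Fin n) (Fin n) ℝ) : Prop :=
  ∀ z ∈ spectrum ℂ (F.map (algebraMap ℝ ℂ)), z.re < 0

/-- The smallest eigenvalue of a (symmetric) real matrix. -/
def lambdaMin {n : ℕ} (M : Matrix (Fin n) (Fin n) ℝ) : ℝ :=
  sInf (spectrum ℝ M)

/-- The largest singular value of a real matrix, that is, its operator norm between Euclidean
spaces. -/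
def norm2 {m n : ℕ} (M : Matrix (Fin m) (Fin n) ℝ) : ℝ :=
  ‖(Matrix.toEuclideanLin M).toContinuousLinearMap‖

/-- The space of symmetric real matrices; it carries the Frobenius norm. -/
def SymMat (n : ℕ) : Submodule ℝ (Matrix (Fin n) (Fin n) ℝ) where
  carrier := {M | M.IsSymm}
  add_mem' := fun ha hb => Matrix.IsSymm.add ha hb
  zero_mem' := Matrix.isSymm_zero
  smul_mem' := fun c _ hM => Matrix.IsSymm.smul hM c

/-- The Lyapunov operator `X ↦ A X + X Aᵀ` on symmetric matrices. -/
def lyap {n : ℕ} (A : Matrix (Fin n) (Fin n) ℝ) : Module.End ℝ (SymMat n) where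
  toFun X := ⟨A * X.1 + X.1 * Aᵀ, by
    have hX : X.1ᵀ = X.1 := X.2
    change (A * X.1 + X.1 * Aᵀ)ᵀ = A * X.1 + X.1 * Aᵀ
    rw [Matrix.transpose_add, Matrix.transpose_mul, Matrix.transpose_mul,
      Matrix.transpose_transpose, hX, add_comm]⟩
  map_add' X Y := by
    apply Subtype.ext
    change A * (X.1 + Y.1) + (X.1 + Y.1) * Aᵀ
      = (A * X.1 + X.1 * Aᵀ) + (A * Y.1 + Y.1 * Aᵀ)
    rw [Matrix.mul_add, Matrix.add_mul]
    abel
  map_smul' c X := by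
    apply Subtype.ext
    change A * (c • X.1) + (c • X.1) * Aᵀ = c • (A * X.1 + X.1 * Aᵀ)
    rw [Matrix.mul_smul, Matrix.smul_mul, smul_add]

/-- The linear map `Y ↦ B Y + Yᵀ Bᵀ` into symmetric matrices. -/
def inputMap {n m : ℕ} (B : Matrix (Fin n) (Fin m) ℝ) :
    Matrix (Fin m) (Fin n) ℝ →ₗ[ℝ] SymMat n where
  toFun Y := ⟨B * Y + Yᵀ * Bᵀ, by
    change (B * Y + Yᵀ * Bᵀ)ᵀ = B * Y + Yᵀ * Bᵀ
    rw [Matrix.transpose_add, Matrix.transpose_mul, Matrix.transpose_mul,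
      Matrix.transpose_transpose, Matrix.transpose_transpose, add_comm]⟩
  map_add' Y Z := by
    apply Subtype.ext
    change B * (Y + Z) + (Y + Z)ᵀ * Bᵀ = (B * Y + Yᵀ * Bᵀ) + (B * Z + Zᵀ * Bᵀ)
    rw [Matrix.mul_add, Matrix.transpose_add, Matrix.add_mul]
    abel
  map_smul' c Y := by
    apply Subtype.ext
    change B * (c • Y) + (c • Y)ᵀ * Bᵀ = c • (B * Y + Yᵀ * Bᵀ)
    rw [Matrix.mul_smul, Matrix.transpose_smul, Matrix.smul_mul, smul_add]

/-- The operator norm `sup ‖T M‖ / ‖M‖` of a linear map between finite-dimensional normed spaces. -/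
def opNorm {E F : Type*} [NormedAddCommGroup E] [NormedSpace ℝ E] [FiniteDimensional ℝ E]
    [NormedAddCommGroup F] [NormedSpace ℝ F] (T : E →ₗ[ℝ] F) : ℝ :=
  ‖T.toContinuousLinearMap‖

/-- Operator norm of `Y ↦ B Y + Yᵀ Bᵀ` with respect to Frobenius norms. -/
def normInputMap {n m : ℕ} (B : Matrix (Fin n) (Fin m) ℝ) : ℝ :=
  opNorm (inputMap B)

/-- Operator norm, with respect to the Frobenius norm, of the inverse of the Lyapunov operator
`X ↦ A X + X Aᵀ` on symmetric matrices (meaningful when this operator is invertible). -/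
def normLyapInv {n : ℕ} (A : Matrix (Fin n) (Fin n) ℝ) : ℝ :=
  opNorm (Ring.inverse (lyap A))

/-- The parameters `(A, B, Q, R, Ω)` of a continuous-time LQR problem with `n` states and `m`
inputs. -/
structure Params (n m : ℕ) where
  A : Matrix (Fin n) (Fin n) ℝ
  B : Matrix (Fin n) (Fin m) ℝ
  Q : Matrix (Fin n) (Fin n) ℝ
  R : Matrix (Fin m) (Fin m) ℝ
  Ω : Matrix (Fin n) (Fin n) ℝ

namespace Params

variable {n m : ℕ} (p : Params n m)

/-- The closed-loop matrix `A - B K`. -/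
def closedLoop (K : Matrix (Fin m) (Fin n) ℝ) : Matrix (Fin n) (Fin n) ℝ :=
  p.A - p.B * K

/-- The set of stabilizing feedback gains. -/
def stabilizing : Set (Matrix (Fin m) (Fin n) ℝ) :=
  {K | IsHurwitz (p.closedLoop K)}

/-- `X(K) = ∫₀^∞ exp((A - BK) t) Ω exp((A - BK)ᵀ t) dt`. -/
def X (K : Matrix (Fin m) (Fin n) ℝ) : Matrix (Fin n) (Fin n) ℝ :=
  ∫ t in Set.Ioi (0 : ℝ),
    NormedSpace.exp (t • p.closedLoop K) * p.Ω * NormedSpace.exp (t • (p.closedLoop K)ᵀ)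

/-- The real number `trace ((Q + Kᵀ R K) X(K))`, the finite value of the LQR cost at a stabilizing
gain `K`. -/
def costValue (K : Matrix (Fin m) (Fin n) ℝ) : ℝ :=
  ((p.Q + Kᵀ * p.R * K) * p.X K).trace

open Classical in
/-- The LQR cost, equal to `+∞` at gains that are not stabilizing. -/
def cost (K : Matrix (Fin m) (Fin n) ℝ) : EReal :=
  if K ∈ p.stabilizing then (p.costValue K : EReal) else ⊤

/-- `K` is an optimal gain: a global minimizer of the LQR cost. -/
def IsOptimal (K : Matrix (Fin m) (Fin n) ℝ) : Prop :=
  ∀ K' : Matrix (Fin m) (Fin n) ℝ, p.cost K ≤ p.cost K'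

/-- `G` is the gradient of `φ` at `K` for the inner product `⟨G, H⟩ = trace (Gᵀ H)`. -/
def _root_.LQR.HasMatrixGradientAt (φ : Matrix (Fin m) (Fin n) ℝ → ℝ)
    (G K : Matrix (Fin m) (Fin n) ℝ) : Prop :=
  ∃ φ' : Matrix (Fin m) (Fin n) ℝ →L[ℝ] ℝ,
    HasFDerivAt φ φ' K ∧ ∀ H : Matrix (Fin m) (Fin n) ℝ, φ' H = (Gᵀ * H).trace

/-- `K : [0, ∞) → 𝒮_K` solves the gradient flow `K' = -∇f(K)` of the LQR cost
(one-sided derivative at `0`). -/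
def IsGradientFlow (K : ℝ → Matrix (Fin m) (Fin n) ℝ) : Prop :=
  ∀ t : ℝ, 0 ≤ t → K t ∈ p.stabilizing ∧
    ∃ G : Matrix (Fin m) (Fin n) ℝ,
      HasMatrixGradientAt p.costValue G (K t) ∧ HasDerivWithinAt K (-G) (Set.Ici 0) t

/-- `ν = (λ_min(Ω)² / 4) (‖A‖ / √λ_min(Q) + ‖B‖ / √λ_min(R))⁻²`. -/
def nu : ℝ :=
  lambdaMin p.Ω ^ 2 / 4 *
    ((norm2 p.A / √(lambdaMin p.Q) + norm2 p.B / √(lambdaMin p.R)) ^ 2)⁻¹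

/-- `η = ‖ℬ‖ / (λ_min(Q) λ_min(Ω) √(ν λ_min(R)))`, where `ℬ Y = B Y + Yᵀ Bᵀ`. -/
def eta : ℝ :=
  normInputMap p.B /
    (lambdaMin p.Q * lambdaMin p.Ω * √(p.nu * lambdaMin p.R))

/-- `μ(a) = 2 λ_min(R) λ_min(Q) / (a (1 + a² η)²)`. -/
def mu (a : ℝ) : ℝ :=
  2 * lambdaMin p.R * lambdaMin p.Q / (a * (1 + a ^ 2 * p.eta) ^ 2)

/-- `c(a) = ν √(ν λ_min(R)) / (2 a² ‖𝒜⁻¹‖ ‖B‖ + a √(ν λ_min(R)))`, where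
`𝒜 X = A X + X Aᵀ`. -/
def c (a : ℝ) : ℝ :=
  p.nu * √(p.nu * lambdaMin p.R) /
    (2 * a ^ 2 * normLyapInv p.A * norm2 p.B + a * √(p.nu * lambdaMin p.R))

/-- `b(a) = a² ‖R‖ / (ν λ_min(R) λ_min(Q))`. -/
def b (a : ℝ) : ℝ :=
  a ^ 2 * norm2 p.R / (p.nu * lambdaMin p.R * lambdaMin p.Q)

end Params

end LQR

end

/-!
The proof works directly in the variable `K` and rests on one exact identity.
Write `F = A - BK`, let `X(K)` solve `F X + X Fᵀ = -Ω`, let `P(K)` solve the dual equation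
`Fᵀ P + P F = -(Q + Kᵀ R K)`, and put `E(K) = R K - Bᵀ P(K)`. For stabilizing `K`, `L` with
difference `D = L - K`, pairing the two Lyapunov equations gives (`costValue_sub`)
`f(L) - f(K) = tr ((Dᵀ R D + Dᵀ E(K) + E(K)ᵀ D) X(L))`.

* As `X` is continuous, this shows `∇f(K) = 2 E(K) X(K)` (`hasFDerivAt_costValue`).
* At a minimizer `K⋆` one has `E(K⋆) = 0`, so that `f(L) - f(K⋆)` is the quadratic form
  `tr (Dᵀ R D X(L))`. This yields uniqueness of the minimizer and the comparison of `f - f(K⋆)` with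
  `‖K - K⋆‖²`, whose two constants have the ratio `b`.
* Taking `L = K⋆` and completing the square, `f(K) - f(K⋆)` is at most a multiple of `‖E(K)‖²`
  (`costValue_sub_le`), while `‖∇f(K)‖ ≥ 2 λ_min(X(K)) ‖E(K)‖`. Together these are a
  Polyak–Łojasiewicz inequality (`gradientRate_mul_le`) with constant `4 λ_min(R) λ_min(Q) ν² / a³`,
  which is at least `2 μ c²` because `η ≥ 0` and `c ≤ ν / a` (`two_mul_mu_mul_c_sq`).

The bound `X(K) ≥ ν / a` on the sublevel set of level `a` (`posSemidef_sub_nu_div`) is obtained by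
testing the Lyapunov equation with a vector and using the Cauchy–Schwarz inequality for `X`. By
Lyapunov's criterion it prevents limits of gains in the sublevel set from losing stability, so
sublevel sets are compact (`isCompact_sublevel`). Hence a minimizer exists, and the gradient field,
cut off outside a sublevel set, becomes a bounded Lipschitz field whose integral curves exist for
all times and do not leave the sublevel set (`existsUnique_isGradientFlow`).

The analytic input on Hurwitz matrices is the exponential decay of `exp(tF)`
(`IsHurwitz.exists_norm_exp_le`), a consequence of the spectral mapping property of the matrix
exponential and of Gelfand's formula.
-/

noncomputable section

namespace LQR

open Matrix Filter Topology

/-! ### Matrix inequalities -/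

lemma frobenius_sq {m n : ℕ} (M : Matrix (Fin m) (Fin n) ℝ) : ‖M‖ ^ 2 = (Mᵀ * M).trace := by
  rw [frobenius_norm_def, ← Real.sqrt_eq_rpow, Real.sq_sqrt (by positivity), trace,
    Finset.sum_comm]
  simp [mul_apply, sq]

lemma dotProduct_self_eq_norm_sq {n : ℕ} (v : Fin n → ℝ) :
    v ⬝ᵥ v = ‖WithLp.toLp 2 v‖ ^ 2 := by
  rw [EuclideanSpace.real_norm_sq_eq]
  simp [dotProduct, sq]

lemma posSemidef_of_dotProduct {n : ℕ} {M : Matrix (Fin n) (Fin n) ℝ} (hM : Mᵀ = M)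
    (h : ∀ v, 0 ≤ v ⬝ᵥ M *ᵥ v) : M.PosSemidef :=
  .of_dotProduct_mulVec_nonneg (by simpa [IsHermitian, conjTranspose_eq_transpose_of_trivial])
    (by simpa using h)

lemma PosSemidef.symm {n : ℕ} {M : Matrix (Fin n) (Fin n) ℝ} (hM : M.PosSemidef) : Mᵀ = M := by
  simpa [IsHermitian, conjTranspose_eq_transpose_of_trivial] using hM.isHermitian

lemma PosSemidef.exists_eq_transpose_mul_self {n : ℕ} {X : Matrix (Fin n) (Fin n) ℝ}
    (hX : X.PosSemidef) : ∃ C : Matrix (Fin n) (Fin n) ℝ, X = Cᵀ * C := by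
  open scoped MatrixOrder in
  obtain ⟨C, hC⟩ := CStarAlgebra.nonneg_iff_eq_star_mul_self.mp hX.nonneg
  exact ⟨C, by rw [hC, star_eq_conjTranspose, conjTranspose_eq_transpose_of_trivial]⟩

lemma trace_mul_nonneg {n : ℕ} {M X : Matrix (Fin n) (Fin n) ℝ} (hM : M.PosSemidef)
    (hX : X.PosSemidef) : 0 ≤ (M * X).trace := by
  obtain ⟨C, hC⟩ := PosSemidef.exists_eq_transpose_mul_self hM
  have := (hX.mul_mul_conjTranspose_same C).trace_nonneg
  rw [hC, mul_assoc, trace_mul_comm]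
  exact this

lemma norm_mulVec_le {m n : ℕ} (M : Matrix (Fin m) (Fin n) ℝ) (v : Fin n → ℝ) :
    ‖WithLp.toLp 2 (M *ᵥ v)‖ ≤ norm2 M * ‖WithLp.toLp 2 v‖ := by
  have := (Matrix.toEuclideanLin M).toContinuousLinearMap.le_opNorm (WithLp.toLp 2 v)
  simpa [norm2, Matrix.toLpLin_apply] using this

lemma norm2_nonneg {m n : ℕ} (M : Matrix (Fin m) (Fin n) ℝ) : 0 ≤ norm2 M := norm_nonneg _

lemma abs_dotProduct_le {n : ℕ} (v w : Fin n → ℝ) :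
    |v ⬝ᵥ w| ≤ ‖WithLp.toLp 2 v‖ * ‖WithLp.toLp 2 w‖ := by
  have := abs_real_inner_le_norm (WithLp.toLp 2 w) (WithLp.toLp 2 v)
  rw [EuclideanSpace.inner_eq_star_dotProduct] at this
  simpa [mul_comm] using this

lemma norm_transpose_mulVec_le {m n : ℕ} (M : Matrix (Fin m) (Fin n) ℝ) (v : Fin m → ℝ) :
    ‖WithLp.toLp 2 (Mᵀ *ᵥ v)‖ ≤ norm2 M * ‖WithLp.toLp 2 v‖ := by
  set w := Mᵀ *ᵥ v with hw
  have h1 : ‖WithLp.toLp 2 w‖ ^ 2 = v ⬝ᵥ M *ᵥ w := by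
    rw [← dotProduct_self_eq_norm_sq, hw, dotProduct_mulVec, vecMul_transpose, dotProduct_comm]
  have h2 := (le_abs_self _).trans (abs_dotProduct_le v (M *ᵥ w))
  have h3 := norm_mulVec_le M w
  rcases (norm_nonneg (WithLp.toLp 2 w)).eq_or_lt with h0 | h0
  · rw [← h0]; exact mul_nonneg (norm2_nonneg _) (norm_nonneg _)
  · refine le_of_mul_le_mul_right ?_ h0
    nlinarith [norm_nonneg (WithLp.toLp 2 v)]

lemma posSemidef_smul_one_sub {n : ℕ} {M : Matrix (Fin n) (Fin n) ℝ} (hM : Mᵀ = M) :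
    (norm2 M • (1 : Matrix (Fin n) (Fin n) ℝ) - M).PosSemidef := by
  refine posSemidef_of_dotProduct (by simp [hM]) fun v => ?_
  have h2 := (le_abs_self _).trans (abs_dotProduct_le v (M *ᵥ v))
  have h3 := norm_mulVec_le M v
  have h4 := dotProduct_self_eq_norm_sq v
  simp only [sub_mulVec, smul_mulVec, one_mulVec, dotProduct_sub, dotProduct_smul, smul_eq_mul]
  rw [h4]
  nlinarith [norm_nonneg (WithLp.toLp 2 v)]

lemma posSemidef_sub_lambdaMin {n : ℕ} {M : Matrix (Fin n) (Fin n) ℝ} (hM : M.IsHermitian) :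
    (M - lambdaMin M • (1 : Matrix (Fin n) (Fin n) ℝ)).PosSemidef := by
  rw [posSemidef_iff_isHermitian_and_spectrum_nonneg]
  refine ⟨hM.sub (by simp [IsHermitian]), fun x hx => ?_⟩
  rw [← Algebra.algebraMap_eq_smul_one, ← spectrum.sub_singleton_eq] at hx
  obtain ⟨y, hy, z, rfl, rfl⟩ := hx
  have hb : BddBelow (spectrum ℝ M) := by
    rw [hM.spectrum_real_eq_range_eigenvalues]
    exact (Set.finite_range _).bddBelow
  exact sub_nonneg.2 (csInf_le hb hy)

lemma lambdaMin_pos {n : ℕ} (hn : 0 < n) {M : Matrix (Fin n) (Fin n) ℝ} (hM : M.PosDef) :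
    0 < lambdaMin M := by
  have hs := hM.isHermitian.spectrum_real_eq_range_eigenvalues
  have : Nonempty (Fin n) := ⟨⟨0, hn⟩⟩
  have hm : lambdaMin M ∈ spectrum ℝ M := by
    refine Set.Nonempty.csInf_mem ?_ ?_ <;> rw [hs]
    · exact Set.range_nonempty _
    · exact Set.finite_range _
  rw [hs] at hm
  obtain ⟨i, hi⟩ := hm
  rw [← hi]
  exact hM.eigenvalues_pos i

lemma lambdaMin_mul_le {n : ℕ} {M : Matrix (Fin n) (Fin n) ℝ} (hM : M.IsHermitian)
    (v : Fin n → ℝ) : lambdaMin M * (v ⬝ᵥ v) ≤ v ⬝ᵥ M *ᵥ v := by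
  have := (posSemidef_sub_lambdaMin hM).dotProduct_mulVec_nonneg v
  simpa [sub_mulVec, smul_mulVec, dotProduct_sub] using this

/-- The Cauchy–Schwarz inequality for the form of a positive semidefinite matrix. -/
lemma PosSemidef.cauchy_schwarz {n : ℕ} {X : Matrix (Fin n) (Fin n) ℝ} (hX : X.PosSemidef)
    (u v : Fin n → ℝ) : (u ⬝ᵥ X *ᵥ v) ^ 2 ≤ (u ⬝ᵥ X *ᵥ u) * (v ⬝ᵥ X *ᵥ v) := by
  obtain ⟨C, hC⟩ := PosSemidef.exists_eq_transpose_mul_self hX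
  have key : ∀ a b : Fin n → ℝ, a ⬝ᵥ X *ᵥ b = (C *ᵥ a) ⬝ᵥ (C *ᵥ b) := fun a b => by
    rw [hC, ← mulVec_mulVec, dotProduct_mulVec, ← mulVec_transpose, transpose_transpose]
  rw [key, key, key, dotProduct_self_eq_norm_sq (C *ᵥ u), dotProduct_self_eq_norm_sq (C *ᵥ v),
    ← mul_pow, ← sq_abs]
  exact pow_le_pow_left₀ (abs_nonneg _) (abs_dotProduct_le _ _) 2

lemma posSemidef_trace_smul_sub {n : ℕ} {X : Matrix (Fin n) (Fin n) ℝ} (hX : X.PosSemidef) :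
    (X.trace • (1 : Matrix (Fin n) (Fin n) ℝ) - X).PosSemidef := by
  refine posSemidef_of_dotProduct (by simp [PosSemidef.symm hX]) fun v => ?_
  -- `(v ⬝ v) 1 - v vᵀ` is positive semidefinite, so its product with `X` has nonnegative trace.
  have h : ((v ⬝ᵥ v) • (1 : Matrix (Fin n) (Fin n) ℝ) - vecMulVec v v).PosSemidef := by
    refine posSemidef_of_dotProduct (by simp) fun w => ?_
    simp only [sub_mulVec, smul_mulVec, one_mulVec, dotProduct_sub, dotProduct_smul, smul_eq_mul,
      vecMulVec_mulVec, op_smul_eq_smul]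
    have := abs_dotProduct_le v w
    rw [dotProduct_self_eq_norm_sq v, dotProduct_self_eq_norm_sq w, dotProduct_comm w v, ← mul_pow,
      ← sq, ← sq_abs (v ⬝ᵥ w), sub_nonneg]
    exact pow_le_pow_left₀ (abs_nonneg _) this 2
  have := trace_mul_nonneg h hX
  rw [sub_mul, trace_sub, vecMulVec_mul, trace_vecMulVec, smul_mul, one_mul, trace_smul] at this
  simp only [sub_mulVec, smul_mulVec, one_mulVec, dotProduct_sub, dotProduct_smul, smul_eq_mul]
  rw [dotProduct_mulVec, dotProduct_comm (v ᵥ* X)]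
  simp only [smul_eq_mul] at this
  linarith

lemma frobenius_norm_le_trace {n : ℕ} {X : Matrix (Fin n) (Fin n) ℝ} (hX : X.PosSemidef) :
    ‖X‖ ≤ X.trace := by
  have := trace_mul_nonneg (posSemidef_trace_smul_sub hX) hX
  rw [sub_mul, trace_sub, smul_mul, one_mul, trace_smul] at this
  refine le_of_sq_le_sq ?_ hX.trace_nonneg
  rw [frobenius_sq, PosSemidef.symm hX]
  simp only [smul_eq_mul] at this
  nlinarith

lemma le_trace_mul_of_sub_posSemidef {m n : ℕ} {X : Matrix (Fin n) (Fin n) ℝ} {c : ℝ}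
    (h : (X - c • (1 : Matrix (Fin n) (Fin n) ℝ)).PosSemidef) (Y : Matrix (Fin m) (Fin n) ℝ) :
    c * ‖Y‖ ^ 2 ≤ (Yᵀ * Y * X).trace := by
  have := trace_mul_nonneg (M := Yᵀ * Y) (by
    simpa [conjTranspose_eq_transpose_of_trivial] using posSemidef_conjTranspose_mul_self Y) h
  rw [mul_sub, trace_sub, Matrix.mul_smul, mul_one, trace_smul, ← frobenius_sq] at this
  simpa using this

lemma trace_mul_le_of_sub_posSemidef {m n : ℕ} {X : Matrix (Fin n) (Fin n) ℝ} {c : ℝ}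
    (h : (c • (1 : Matrix (Fin n) (Fin n) ℝ) - X).PosSemidef) (Y : Matrix (Fin m) (Fin n) ℝ) :
    (Yᵀ * Y * X).trace ≤ c * ‖Y‖ ^ 2 := by
  have := trace_mul_nonneg (M := Yᵀ * Y) (by
    simpa [conjTranspose_eq_transpose_of_trivial] using posSemidef_conjTranspose_mul_self Y) h
  rw [mul_sub, trace_sub, Matrix.mul_smul, mul_one, trace_smul, ← frobenius_sq] at this
  simpa using this

lemma PosSemidef.dotProduct_le_trace {n : ℕ} {X : Matrix (Fin n) (Fin n) ℝ} (hX : X.PosSemidef)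
    (v : Fin n → ℝ) : v ⬝ᵥ X *ᵥ v ≤ X.trace * (v ⬝ᵥ v) := by
  have := (posSemidef_trace_smul_sub hX).dotProduct_mulVec_nonneg v
  simpa [sub_mulVec, smul_mulVec, dotProduct_sub] using this

/-- If `X ≥ c` then `X² ≥ c²`, so right multiplication by `X` expands Frobenius norms by `c`. -/
lemma sq_mul_le_norm_mul_sq {m n : ℕ} {X : Matrix (Fin n) (Fin n) ℝ} {c : ℝ} (hc : 0 ≤ c)
    (h : (X - c • (1 : Matrix (Fin n) (Fin n) ℝ)).PosSemidef) (Y : Matrix (Fin m) (Fin n) ℝ) :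
    c ^ 2 * ‖Y‖ ^ 2 ≤ ‖Y * X‖ ^ 2 := by
  have hX : Xᵀ = X := by
    have := PosSemidef.symm h
    simpa using this
  have h1 := le_trace_mul_of_sub_posSemidef h Y
  have h2 : 0 ≤ ‖Y * (X - c • (1 : Matrix (Fin n) (Fin n) ℝ))‖ ^ 2 := by positivity
  rw [frobenius_sq, Matrix.mul_sub, Matrix.mul_smul, Matrix.mul_one, transpose_sub,
    transpose_smul, Matrix.sub_mul, Matrix.mul_sub, Matrix.mul_sub] at h2
  simp only [Matrix.mul_smul, Matrix.smul_mul, trace_sub, trace_smul, smul_eq_mul,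
    ← frobenius_sq] at h2
  have e1 : ((Y * X)ᵀ * Y).trace = (Yᵀ * Y * X).trace := by
    rw [transpose_mul, hX, Matrix.mul_assoc, trace_mul_comm]
  have e2 : (Yᵀ * (Y * X)).trace = (Yᵀ * Y * X).trace := by rw [Matrix.mul_assoc]
  rw [e1, e2] at h2
  nlinarith

/-- The uniform structure of the Frobenius norm. It agrees with the entrywise uniform structure
on matrices, but only after unfolding definitions; preferring it makes the theory of normed spaces
apply to matrices. -/
local instance frobeniusUniformSpace {m n : ℕ} {α : Type*} [NormedAddCommGroup α] :
    UniformSpace (Matrix (Fin m) (Fin n) α) := PseudoMetricSpace.toUniformSpace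

/-- The topology of the Frobenius norm, definitionally equal to the entrywise topology. -/
local instance frobeniusTopologicalSpace {m n : ℕ} {α : Type*} [NormedAddCommGroup α] :
    TopologicalSpace (Matrix (Fin m) (Fin n) α) := UniformSpace.toTopologicalSpace

/-! ### Exponential decay of the exponential of a Hurwitz matrix -/

lemma exp_transpose {n : ℕ} (M : Matrix (Fin n) (Fin n) ℝ) :
    NormedSpace.exp Mᵀ = (NormedSpace.exp M)ᵀ :=
  Matrix.exp_transpose M

lemma exp_mulVec_of_eigenvector {n : ℕ} {M : Matrix (Fin n) (Fin n) ℂ} {z : ℂ} {w : Fin n → ℂ}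
    (h : M *ᵥ w = z • w) : NormedSpace.exp M *ᵥ w = Complex.exp z • w := by
  have h1 := (NormedSpace.exp_series_hasSum_exp' (𝕂 := ℂ) M).mapL
    (LinearMap.toContinuousLinearMap (Matrix.mulVecBilin ℂ ℂ |>.flip w))
  have h2 := ((NormedSpace.exp_series_hasSum_exp' (𝕂 := ℂ) z).smul_const w)
  have hk : ∀ k : ℕ, M ^ k *ᵥ w = z ^ k • w := by
    intro k
    induction k with
    | zero => simp
    | succ k ih => rw [pow_succ, ← mulVec_mulVec, h, mulVec_smul, ih, smul_smul, pow_succ']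
  rw [← Complex.exp_eq_exp_ℂ] at h2
  have h3 : (fun k : ℕ => ((k.factorial : ℂ)⁻¹ • M ^ k) *ᵥ w)
      = fun k : ℕ => ((k.factorial : ℂ)⁻¹ • z ^ k) • w := by
    ext1 k
    rw [smul_mulVec, hk, smul_smul, smul_eq_mul]
  replace h1 : HasSum (fun k : ℕ => ((k.factorial : ℂ)⁻¹ • M ^ k) *ᵥ w)
    (NormedSpace.exp M *ᵥ w) := h1
  rw [h3] at h1
  exact h1.unique h2

/-- The exponential of a complex matrix has no eigenvalues besides the exponentials of eigenvalues:
an eigenspace of `exp M` is invariant under `M`, hence contains an eigenvector of `M`. -/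
lemma exists_exp_eq_of_mem_spectrum_exp {n : ℕ} {M : Matrix (Fin n) (Fin n) ℂ} {μ : ℂ}
    (hμ : μ ∈ spectrum ℂ (NormedSpace.exp M)) : ∃ z ∈ spectrum ℂ M, μ = Complex.exp z := by
  rw [← spectrum_toLin', ← Module.End.hasEigenvalue_iff_mem_spectrum] at hμ
  set f : Module.End ℂ (Fin n → ℂ) := toLin' M
  set g : Module.End ℂ (Fin n → ℂ) := toLin' (NormedSpace.exp M)
  have hc : Commute f g := by
    have : Commute M (NormedSpace.exp M) := (Commute.refl M).exp_right
    change f * g = g * f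
    rw [Module.End.mul_eq_comp, Module.End.mul_eq_comp, ← toLin'_mul, ← toLin'_mul, this.eq]
  have hmaps : Set.MapsTo f (g.eigenspace μ) (g.eigenspace μ) :=
    Module.End.mapsTo_genEigenspace_of_comm hc.symm μ 1
  have : Nontrivial (g.eigenspace μ) := Submodule.nontrivial_iff_ne_bot.2 hμ
  obtain ⟨z, hz⟩ := Module.End.exists_eigenvalue (f.restrict hmaps)
  obtain ⟨⟨w, hwμ⟩, hw⟩ := hz.exists_hasEigenvector
  have hw0 : w ≠ 0 := fun h => hw.2 (by simp [h])
  have hfw : M *ᵥ w = z • w := by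
    have : f w = z • w := congrArg Subtype.val hw.apply_eq_smul
    simpa [f] using this
  refine ⟨z, ?_, ?_⟩
  · rw [← spectrum_toLin', ← Module.End.hasEigenvalue_iff_mem_spectrum]
    exact Module.End.hasEigenvalue_of_hasEigenvector
      ⟨Module.End.mem_eigenspace_iff.2 (by simpa [f] using hfw), hw0⟩
  · have h1 : NormedSpace.exp M *ᵥ w = μ • w := by
      simpa [g] using Module.End.mem_eigenspace_iff.1 hwμ
    rw [exp_mulVec_of_eigenvector hfw] at h1
    exact (smul_left_injective ℂ hw0 h1).symm

lemma IsHurwitz.exists_norm_exp_pow_lt_one {n : ℕ} (hn : 0 < n) {F : Matrix (Fin n) (Fin n) ℝ}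
    (hF : IsHurwitz F) : ∃ N : ℕ, 0 < N ∧ ‖NormedSpace.exp F ^ N‖ < 1 := by
  have : Nonempty (Fin n) := ⟨⟨0, hn⟩⟩
  set φ : Matrix (Fin n) (Fin n) ℝ →+* Matrix (Fin n) (Fin n) ℂ := (algebraMap ℝ ℂ).mapMatrix
  have hφn : ∀ M, ‖φ M‖ = ‖M‖ := fun M => frobenius_norm_map_eq M _ (fun a => by simp)
  have hφc : Continuous φ := continuous_id.matrix_map Complex.continuous_ofReal
  set M := NormedSpace.exp (φ F) with hM
  have hlt : spectralRadius ℂ M < (1 : NNReal) := by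
    refine spectrum.spectralRadius_lt_of_forall_lt M fun μ hμ => ?_
    obtain ⟨z, hz, rfl⟩ := exists_exp_eq_of_mem_spectrum_exp hμ
    rw [← NNReal.coe_lt_coe, coe_nnnorm, Complex.norm_exp, NNReal.coe_one, Real.exp_lt_one_iff]
    exact hF z hz
  have hev :=
    (spectrum.pow_nnnorm_pow_one_div_tendsto_nhds_spectralRadius M).eventually_lt_const hlt
  obtain ⟨N, hN, hN0⟩ := (hev.and (eventually_gt_atTop 0)).exists
  refine ⟨N, hN0, ?_⟩
  rw [← hφn, map_pow, show φ (NormedSpace.exp F) = M from NormedSpace.map_exp φ hφc F]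
  by_contra! h
  refine absurd hN (not_lt.2 ?_)
  have h1 : (1 : ENNReal) ≤ ((‖M ^ N‖₊ : NNReal) : ENNReal) := by
    rw [← ENNReal.coe_one, ENNReal.coe_le_coe, ← NNReal.coe_le_coe]; exact h
  simpa using ENNReal.rpow_le_rpow h1 (show (0 : ℝ) ≤ 1 / (N : ℝ) by positivity)

lemma IsHurwitz.exists_norm_exp_le {n : ℕ} (hn : 0 < n) {F : Matrix (Fin n) (Fin n) ℝ}
    (hF : IsHurwitz F) : ∃ C β : ℝ, 0 ≤ C ∧ 0 < β ∧
      ∀ t : ℝ, 0 ≤ t → ‖NormedSpace.exp (t • F)‖ ≤ C * Real.exp (-β * t) := by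
  obtain ⟨N, hN, hq⟩ := hF.exists_norm_exp_pow_lt_one hn
  set q := max ‖NormedSpace.exp F ^ N‖ (1 / 2)
  have hq0 : 0 < q := lt_max_of_lt_right (by norm_num)
  have hq1 : q < 1 := max_lt hq (by norm_num)
  have hcont : Continuous fun t : ℝ => NormedSpace.exp (t • F) :=
    continuous_iff_continuousAt.2 fun t => (hasDerivAt_exp_smul_const F t).continuousAt
  obtain ⟨D, hD⟩ := (isCompact_Icc (a := (0 : ℝ)) (b := N)).exists_bound_of_continuousOn
    hcont.continuousOn
  have hD0 : 0 ≤ D := (norm_nonneg _).trans (hD 0 ⟨le_rfl, by positivity⟩)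
  have hNr : (0 : ℝ) < N := by exact_mod_cast hN
  have hpow : ∀ k : ℕ, ∀ s ∈ Set.Icc (0 : ℝ) N,
      ‖NormedSpace.exp ((s + k * N) • F)‖ ≤ D * q ^ k := by
    intro k s hs
    induction k with
    | zero => simpa using hD s hs
    | succ k ih =>
      have : NormedSpace.exp ((s + (k + 1 : ℕ) * N) • F)
          = NormedSpace.exp ((s + k * N) • F) * NormedSpace.exp F ^ N := by
        rw [← NormedSpace.exp_nsmul, ← NormedSpace.exp_add_of_commute]
        · congr 1
          rw [← Nat.cast_smul_eq_nsmul ℝ, ← add_smul]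
          push_cast; ring_nf
        · exact ((Commute.refl F).smul_left _).smul_right _
      rw [this, pow_succ, ← mul_assoc]
      refine (norm_mul_le _ _).trans ?_
      exact mul_le_mul ih (le_max_left _ _) (norm_nonneg _) (by positivity)
  refine ⟨D * q⁻¹, -Real.log q / N, by positivity,
    div_pos (by simpa using Real.log_neg hq0 hq1) hNr, fun t ht => ?_⟩
  set k := ⌊t / N⌋₊
  have hk1 : (k : ℝ) * N ≤ t := (le_div_iff₀ hNr).1 (Nat.floor_le (by positivity))
  have hk2 : t / N < k + 1 := Nat.lt_floor_add_one _
  have hk3 : t < (k + 1) * N := (div_lt_iff₀ hNr).1 hk2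
  have h1 := hpow k (t - k * N) ⟨by linarith, by linarith⟩
  rw [sub_add_cancel] at h1
  refine h1.trans ?_
  rw [mul_assoc]
  refine mul_le_mul_of_nonneg_left ?_ hD0
  rw [← Real.rpow_natCast, Real.rpow_def_of_pos hq0]
  conv_rhs => rw [← Real.exp_log (inv_pos.2 hq0), ← Real.exp_add, Real.log_inv]
  rw [Real.exp_le_exp]
  have := Real.log_neg hq0 hq1
  have e : -(-Real.log q / N) * t = Real.log q * (t / N) := by ring
  rw [e]
  nlinarith

/-! ### The Lyapunov equation -/

/-- The Lyapunov operator `X ↦ F X + X Fᵀ` on all square matrices, as a linear function of `F`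
with values in the continuous linear maps. -/
def lyapunovMap (n : ℕ) : Matrix (Fin n) (Fin n) ℝ →ₗ[ℝ]
    (Matrix (Fin n) (Fin n) ℝ →L[ℝ] Matrix (Fin n) (Fin n) ℝ) where
  toFun F := LinearMap.toContinuousLinearMap (LinearMap.mulLeft ℝ F + LinearMap.mulRight ℝ Fᵀ)
  map_add' F G := by
    ext1 X
    simp [add_mul, mul_add]
    abel
  map_smul' c F := by
    ext1 X
    simp

@[simp]
lemma lyapunovMap_apply {n : ℕ} (F X : Matrix (Fin n) (Fin n) ℝ) :
    lyapunovMap n F X = F * X + X * Fᵀ := by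
  simp [lyapunovMap]

/-- The integrand `exp(tF) W exp(tFᵀ)` of the solution of the Lyapunov equation. -/
def lyapunovFlow {n : ℕ} (F W : Matrix (Fin n) (Fin n) ℝ) (t : ℝ) : Matrix (Fin n) (Fin n) ℝ :=
  NormedSpace.exp (t • F) * W * NormedSpace.exp (t • Fᵀ)

lemma hasDerivAt_lyapunovFlow {n : ℕ} (F W : Matrix (Fin n) (Fin n) ℝ) (t : ℝ) :
    HasDerivAt (lyapunovFlow F W) (lyapunovMap n F (lyapunovFlow F W t)) t := by
  have h := ((hasDerivAt_exp_smul_const' F t).mul_const W).mul (hasDerivAt_exp_smul_const Fᵀ t)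
  have e : lyapunovMap n F (lyapunovFlow F W t)
      = F * NormedSpace.exp (t • F) * W * NormedSpace.exp (t • Fᵀ)
        + NormedSpace.exp (t • F) * W * (NormedSpace.exp (t • Fᵀ) * Fᵀ) := by
    simp [lyapunovFlow, mul_assoc]
  rw [e]
  exact h

lemma lyapunovFlow_lyapunovMap {n : ℕ} (F W : Matrix (Fin n) (Fin n) ℝ) (t : ℝ) :
    lyapunovFlow F (lyapunovMap n F W) t = lyapunovMap n F (lyapunovFlow F W t) := by
  have h1 : NormedSpace.exp (t • F) * F = F * NormedSpace.exp (t • F) :=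
    (((Commute.refl F).smul_right t).exp_right).eq.symm
  have h2 : NormedSpace.exp (t • Fᵀ) * Fᵀ = Fᵀ * NormedSpace.exp (t • Fᵀ) :=
    (((Commute.refl Fᵀ).smul_right t).exp_right).eq.symm
  simp only [lyapunovFlow, lyapunovMap_apply, mul_add, add_mul]
  rw [← mul_assoc, h1, mul_assoc _ _ Fᵀ, h2]
  simp only [mul_assoc]

lemma IsHurwitz.exists_norm_lyapunovFlow_le {n : ℕ} (hn : 0 < n) {F : Matrix (Fin n) (Fin n) ℝ}
    (hF : IsHurwitz F) (W : Matrix (Fin n) (Fin n) ℝ) : ∃ C β : ℝ, 0 < β ∧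
      ∀ t : ℝ, 0 ≤ t → ‖lyapunovFlow F W t‖ ≤ C * Real.exp (-β * t) := by
  obtain ⟨C, β, hC, hβ, h⟩ := hF.exists_norm_exp_le hn
  refine ⟨C * ‖W‖ * C, 2 * β, by positivity, fun t ht => ?_⟩
  have h2 : ‖NormedSpace.exp (t • Fᵀ)‖ = ‖NormedSpace.exp (t • F)‖ := by
    rw [← transpose_smul, LQR.exp_transpose, frobenius_norm_transpose]
  have e : Real.exp (-(2 * β) * t) = Real.exp (-β * t) * Real.exp (-β * t) := by
    rw [← Real.exp_add]; ring_nf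
  calc ‖lyapunovFlow F W t‖ ≤ ‖NormedSpace.exp (t • F)‖ * ‖W‖ * ‖NormedSpace.exp (t • Fᵀ)‖ :=
        (norm_mul_le _ _).trans (mul_le_mul_of_nonneg_right (norm_mul_le _ _) (norm_nonneg _))
    _ ≤ (C * Real.exp (-β * t)) * ‖W‖ * (C * Real.exp (-β * t)) := by
        rw [h2]
        have := h t ht
        gcongr
    _ = C * ‖W‖ * C * Real.exp (-(2 * β) * t) := by rw [e]; ring

lemma IsHurwitz.tendsto_lyapunovFlow {n : ℕ} (hn : 0 < n) {F : Matrix (Fin n) (Fin n) ℝ}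
    (hF : IsHurwitz F) (W : Matrix (Fin n) (Fin n) ℝ) :
    Tendsto (lyapunovFlow F W) atTop (𝓝 0) := by
  obtain ⟨C, β, hβ, h⟩ := hF.exists_norm_lyapunovFlow_le hn W
  refine squeeze_zero_norm' ((eventually_ge_atTop 0).mono h) ?_
  have : Tendsto (fun t : ℝ => Real.exp (-β * t)) atTop (𝓝 0) :=
    Real.tendsto_exp_atBot.comp (tendsto_id.const_mul_atTop_of_neg (neg_neg_of_pos hβ))
  simpa using this.const_mul C

lemma IsHurwitz.integrableOn_lyapunovFlow {n : ℕ} (hn : 0 < n) {F : Matrix (Fin n) (Fin n) ℝ}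
    (hF : IsHurwitz F) (W : Matrix (Fin n) (Fin n) ℝ) :
    MeasureTheory.IntegrableOn (lyapunovFlow F W) (Set.Ioi 0) := by
  obtain ⟨C, β, hβ, h⟩ := hF.exists_norm_lyapunovFlow_le hn W
  have hc : Continuous (lyapunovFlow F W) :=
    continuous_iff_continuousAt.2 fun t => (hasDerivAt_lyapunovFlow F W t).continuousAt
  refine MeasureTheory.Integrable.mono' ((exp_neg_integrableOn_Ioi 0 hβ).const_mul C)
    hc.aestronglyMeasurable ?_
  exact (MeasureTheory.ae_restrict_iff' measurableSet_Ioi).2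
    (Filter.Eventually.of_forall fun t ht => h t (le_of_lt ht))

/-- The integral `∫₀^∞ exp(tF) W exp(tFᵀ) dt` solves the Lyapunov equation. -/
lemma IsHurwitz.lyapunovMap_integral {n : ℕ} (hn : 0 < n) {F : Matrix (Fin n) (Fin n) ℝ}
    (hF : IsHurwitz F) (W : Matrix (Fin n) (Fin n) ℝ) :
    lyapunovMap n F (∫ t in Set.Ioi (0 : ℝ), lyapunovFlow F W t) = -W := by
  have hi := hF.integrableOn_lyapunovFlow hn W
  rw [← ContinuousLinearMap.integral_comp_comm _ hi,
    MeasureTheory.integral_Ioi_of_hasDerivAt_of_tendsto'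
      (fun t _ => hasDerivAt_lyapunovFlow F W t)
      ((lyapunovMap n F).integrable_comp hi) (hF.tendsto_lyapunovFlow hn W)]
  simp [lyapunovFlow]

lemma IsHurwitz.isUnit_lyapunovMap {n : ℕ} (hn : 0 < n) {F : Matrix (Fin n) (Fin n) ℝ}
    (hF : IsHurwitz F) : IsUnit (lyapunovMap n F) := by
  have hinj : Function.Injective (lyapunovMap n F) := by
    refine (injective_iff_map_eq_zero _).2 fun W hW => ?_
    have h1 := hF.lyapunovMap_integral hn W
    rw [← ContinuousLinearMap.integral_comp_comm _ (hF.integrableOn_lyapunovFlow hn W)] at h1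
    simp_rw [← lyapunovFlow_lyapunovMap, hW] at h1
    simpa [lyapunovFlow] using h1
  refine ContinuousLinearMap.isUnit_iff_bijective.2 ⟨hinj, ?_⟩
  exact (LinearMap.injective_iff_surjective (f := (lyapunovMap n F).toLinearMap)).1 hinj

lemma IsHurwitz.lyapunovMap_injective {n : ℕ} (hn : 0 < n) {F : Matrix (Fin n) (Fin n) ℝ}
    (hF : IsHurwitz F) : Function.Injective (lyapunovMap n F) :=
  (ContinuousLinearMap.isUnit_iff_bijective.1 (hF.isUnit_lyapunovMap hn)).1

/-- The continuous linear functional `M ↦ vᵀ M v` on matrices. -/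
def vecForm {n : ℕ} (v : Fin n → ℝ) : Matrix (Fin n) (Fin n) ℝ →L[ℝ] ℝ :=
  LinearMap.toContinuousLinearMap
    { toFun := fun M => v ⬝ᵥ M *ᵥ v
      map_add' := fun M N => by rw [add_mulVec, dotProduct_add]
      map_smul' := fun c M => by rw [smul_mulVec, dotProduct_smul]; rfl }

lemma IsHurwitz.transpose {n : ℕ} {F : Matrix (Fin n) (Fin n) ℝ} (hF : IsHurwitz F) :
    IsHurwitz Fᵀ := by
  intro z hz
  refine hF z ?_
  rw [mem_spectrum_iff_isRoot_charpoly] at hz ⊢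
  rwa [transpose_map, charpoly_transpose] at hz

lemma transpose_lyapunovMap {n : ℕ} (F X : Matrix (Fin n) (Fin n) ℝ) :
    (lyapunovMap n F X)ᵀ = lyapunovMap n F Xᵀ := by
  simp [transpose_mul, add_comm]

lemma IsHurwitz.transpose_eq_of_lyapunovMap {n : ℕ} (hn : 0 < n) {F : Matrix (Fin n) (Fin n) ℝ}
    (hF : IsHurwitz F) {X W : Matrix (Fin n) (Fin n) ℝ} (hW : Wᵀ = W)
    (h : lyapunovMap n F X = -W) : Xᵀ = X := by
  refine hF.lyapunovMap_injective hn ?_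
  rw [← transpose_lyapunovMap, h, transpose_neg, hW]

/-- For positive semidefinite `W` the solution of the Lyapunov equation is positive semidefinite,
being an integral of the congruent matrices `exp(tF) W exp(tF)ᵀ`. -/
lemma IsHurwitz.posSemidef_of_lyapunovMap {n : ℕ} (hn : 0 < n) {F : Matrix (Fin n) (Fin n) ℝ}
    (hF : IsHurwitz F) {X W : Matrix (Fin n) (Fin n) ℝ} (hW : W.PosSemidef)
    (h : lyapunovMap n F X = -W) : X.PosSemidef := by
  refine posSemidef_of_dotProduct
    (hF.transpose_eq_of_lyapunovMap hn (PosSemidef.symm hW) h) fun v => ?_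
  have hX : X = ∫ t in Set.Ioi (0 : ℝ), lyapunovFlow F W t :=
    hF.lyapunovMap_injective hn (by rw [h, hF.lyapunovMap_integral hn])
  change 0 ≤ vecForm v X
  rw [hX, ← ContinuousLinearMap.integral_comp_comm _ (hF.integrableOn_lyapunovFlow hn W)]
  refine MeasureTheory.integral_nonneg fun t => ?_
  have := (hW.mul_mul_conjTranspose_same (NormedSpace.exp (t • F))).dotProduct_mulVec_nonneg v
  rw [conjTranspose_eq_transpose_of_trivial, ← LQR.exp_transpose, transpose_smul] at this
  rw [star_trivial] at this
  exact this

/-- Lyapunov's criterion: `F` is Hurwitz if the Lyapunov equation has a positive definite solution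
for some positive definite right-hand side. -/
lemma isHurwitz_of_lyapunov {n : ℕ} {F X W : Matrix (Fin n) (Fin n) ℝ} (hX : X.PosDef)
    (hW : W.PosDef) (h : F * X + X * Fᵀ = -W) : IsHurwitz F := by
  intro z hz
  have hdet : (algebraMap ℂ (Matrix (Fin n) (Fin n) ℂ) z - F.map (algebraMap ℝ ℂ)).det = 0 := by
    rw [spectrum.mem_iff, isUnit_iff_isUnit_det, isUnit_iff_ne_zero, not_not] at hz
    exact hz
  obtain ⟨w, hw0, hw⟩ := exists_vecMul_eq_zero_iff.2 hdet
  rw [Algebra.algebraMap_eq_smul_one, vecMul_sub, vecMul_smul, vecMul_one, sub_eq_zero] at hw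
  -- The left eigenvector `u + i v` and eigenvalue `z` give two real equations.
  set u : Fin n → ℝ := fun i => (w i).re with hu
  set v : Fin n → ℝ := fun i => (w i).im with hv
  have huF : Fᵀ *ᵥ u = z.re • u - z.im • v := by
    ext j
    have := congrArg Complex.re (congrFun hw j)
    simp [vecMul, dotProduct] at this
    simp [mulVec, dotProduct, hu, hv, this, mul_comm]
  have hvF : Fᵀ *ᵥ v = z.im • u + z.re • v := by
    ext j
    have := congrArg Complex.im (congrFun hw j)
    simp [vecMul, dotProduct] at this
    simp [mulVec, dotProduct, hu, hv, mul_comm, add_comm] at this ⊢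
    linarith
  have hsymm : ∀ a b, a ⬝ᵥ X *ᵥ b = b ⬝ᵥ X *ᵥ a := fun a b => by
    rw [dotProduct_mulVec, ← mulVec_transpose, PosSemidef.symm hX.posSemidef, dotProduct_comm]
  have hform : ∀ a, 2 * ((Fᵀ *ᵥ a) ⬝ᵥ X *ᵥ a) = -(a ⬝ᵥ W *ᵥ a) := fun a => by
    have e1 : a ⬝ᵥ (F * X) *ᵥ a = (Fᵀ *ᵥ a) ⬝ᵥ X *ᵥ a := by
      rw [← mulVec_mulVec, dotProduct_mulVec, mulVec_transpose]
    have e2 : a ⬝ᵥ (X * Fᵀ) *ᵥ a = (Fᵀ *ᵥ a) ⬝ᵥ X *ᵥ a := by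
      rw [← mulVec_mulVec, hsymm]
    have := congrArg (fun M => a ⬝ᵥ M *ᵥ a) h
    simp only [add_mulVec, neg_mulVec, dotProduct_add, dotProduct_neg, e1, e2] at this
    linarith
  have h1 := hform u
  have h2 := hform v
  rw [huF] at h1
  rw [hvF] at h2
  simp only [sub_dotProduct, add_dotProduct, smul_dotProduct, smul_eq_mul] at h1 h2
  have h3 := hsymm u v
  have hX' : ∀ a, 0 ≤ a ⬝ᵥ X *ᵥ a := fun a => by
    simpa using hX.posSemidef.dotProduct_mulVec_nonneg a
  have hW' : ∀ a, 0 ≤ a ⬝ᵥ W *ᵥ a := fun a => by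
    simpa using hW.posSemidef.dotProduct_mulVec_nonneg a
  have hWpos : 0 < u ⬝ᵥ W *ᵥ u + v ⬝ᵥ W *ᵥ v := by
    by_cases hu0 : u = 0
    · have hv0 : v ≠ 0 := fun hv0 => hw0 (by
        ext i
        exact Complex.ext (congrFun hu0 i) (congrFun hv0 i))
      have := hW.dotProduct_mulVec_pos hv0
      simp only [star_trivial] at this
      linarith [hW' u]
    · have := hW.dotProduct_mulVec_pos hu0
      simp only [star_trivial] at this
      linarith [hW' v]
  have h5 : 2 * z.re * (u ⬝ᵥ X *ᵥ u + v ⬝ᵥ X *ᵥ v) < 0 := by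
    rw [h3] at h2
    linarith
  by_contra! hz0
  have := mul_nonneg hz0 (add_nonneg (hX' u) (hX' v))
  linarith

namespace Params

variable {n m : ℕ} {p : Params n m}

/-! ### The cost and the two Lyapunov equations -/

lemma lyapunovMap_X (hn : 0 < n) {K : Matrix (Fin m) (Fin n) ℝ} (hK : K ∈ p.stabilizing) :
    lyapunovMap n (p.closedLoop K) (p.X K) = -p.Ω :=
  IsHurwitz.lyapunovMap_integral hn hK p.Ω

lemma X_eq_inverse (hn : 0 < n) {K : Matrix (Fin m) (Fin n) ℝ} (hK : K ∈ p.stabilizing) :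
    p.X K = Ring.inverse (lyapunovMap n (p.closedLoop K)) (-p.Ω) := by
  rw [← lyapunovMap_X hn hK, ← mul_apply_eq_comp,
    Ring.inverse_mul_cancel _ (IsHurwitz.isUnit_lyapunovMap hn hK), one_apply_eq_self]

lemma X_posSemidef (hn : 0 < n) (hΩ : p.Ω.PosDef) {K : Matrix (Fin m) (Fin n) ℝ}
    (hK : K ∈ p.stabilizing) : (p.X K).PosSemidef :=
  IsHurwitz.posSemidef_of_lyapunovMap hn hK hΩ.posSemidef (lyapunovMap_X hn hK)

variable (p) in
/-- The matrix `P(K)` of the quadratic cost-to-go under the gain `K`, that is, the solution of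
`(A - BK)ᵀ P + P (A - BK) = -(Q + Kᵀ R K)`. At gains which are not stabilizing the value is
irrelevant. -/
def costToGo (K : Matrix (Fin m) (Fin n) ℝ) : Matrix (Fin n) (Fin n) ℝ :=
  Ring.inverse (lyapunovMap n (p.closedLoop K)ᵀ) (-(p.Q + Kᵀ * p.R * K))

lemma lyapunovMap_costToGo (hn : 0 < n) {K : Matrix (Fin m) (Fin n) ℝ} (hK : K ∈ p.stabilizing) :
    lyapunovMap n (p.closedLoop K)ᵀ (p.costToGo K) = -(p.Q + Kᵀ * p.R * K) := by
  rw [costToGo, ← mul_apply_eq_comp,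
    Ring.mul_inverse_cancel _ (IsHurwitz.isUnit_lyapunovMap hn (IsHurwitz.transpose hK)),
    one_apply_eq_self]

lemma transpose_costToGo (hn : 0 < n) (hQ : p.Q.PosDef) (hR : p.R.PosDef)
    {K : Matrix (Fin m) (Fin n) ℝ} (hK : K ∈ p.stabilizing) :
    (p.costToGo K)ᵀ = p.costToGo K := by
  refine (IsHurwitz.transpose hK).transpose_eq_of_lyapunovMap hn ?_ (lyapunovMap_costToGo hn hK)
  simp [transpose_mul, PosSemidef.symm hQ.posSemidef, PosSemidef.symm hR.posSemidef,
    Matrix.mul_assoc]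

variable (p) in
/-- The factor `E(K) = R K - Bᵀ P(K)` of the gradient `2 E(K) X(K)` of the cost. -/
def gradFactor (K : Matrix (Fin m) (Fin n) ℝ) : Matrix (Fin m) (Fin n) ℝ :=
  p.R * K - p.Bᵀ * p.costToGo K

/-- The exact increment of the cost between two stabilizing gains. It is quadratic in the increment
of the gain, with the state covariance `X` taken at the new gain. -/
lemma costValue_sub (hn : 0 < n) (hQ : p.Q.PosDef) (hR : p.R.PosDef)
    {K L : Matrix (Fin m) (Fin n) ℝ} (hK : K ∈ p.stabilizing) (hL : L ∈ p.stabilizing) :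
    p.costValue L - p.costValue K =
      (((L - K)ᵀ * p.R * (L - K) + (L - K)ᵀ * p.gradFactor K
        + (p.gradFactor K)ᵀ * (L - K)) * p.X L).trace := by
  set P := p.costToGo K with hP
  have hPs : Pᵀ = P := transpose_costToGo hn hQ hR hK
  have hRs : p.Rᵀ = p.R := PosSemidef.symm hR.posSemidef
  have h1 := lyapunovMap_costToGo hn hK
  rw [lyapunovMap_apply, transpose_transpose] at h1
  -- Both pairings of `P` with the equation of `X` give `tr (P Ω)`.
  have hdual : ∀ {J : Matrix (Fin m) (Fin n) ℝ}, J ∈ p.stabilizing →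
      (((p.closedLoop J)ᵀ * P + P * p.closedLoop J) * p.X J).trace = -(P * p.Ω).trace := by
    intro J hJ
    have hX := lyapunovMap_X hn hJ
    rw [lyapunovMap_apply] at hX
    rw [← trace_neg, ← Matrix.mul_neg, ← hX, Matrix.add_mul, Matrix.mul_add, trace_add, trace_add,
      Matrix.mul_assoc, trace_mul_comm, Matrix.mul_assoc, Matrix.mul_assoc, add_comm]
  have hKc : p.costValue K = (P * p.Ω).trace := by
    have := hdual hK
    rw [h1, Matrix.neg_mul, trace_neg, neg_inj] at this
    exact this
  have hF : p.closedLoop L = p.closedLoop K - p.B * (L - K) := by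
    simp [closedLoop, Matrix.mul_sub]
  have hE : (p.gradFactor K)ᵀ = Kᵀ * p.R - P * p.B := by
    rw [gradFactor, transpose_sub, transpose_mul, transpose_mul, hRs, transpose_transpose, ← hP,
      hPs]
  have key : p.Q + Lᵀ * p.R * L
      = -((p.closedLoop L)ᵀ * P + P * p.closedLoop L) + ((L - K)ᵀ * p.R * (L - K)
        + (L - K)ᵀ * p.gradFactor K + (p.gradFactor K)ᵀ * (L - K)) := by
    have h2 : p.Q = -((p.closedLoop K)ᵀ * P + P * p.closedLoop K) - Kᵀ * p.R * K := by
      rw [h1]; abel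
    rw [hE, gradFactor, ← hP, h2, hF]
    simp only [transpose_sub, transpose_mul, Matrix.mul_sub, Matrix.sub_mul, Matrix.mul_assoc]
    abel
  rw [hKc, costValue, key, Matrix.add_mul, trace_add, Matrix.neg_mul, trace_neg, hdual hL]
  ring

/-! ### A priori bounds on sublevel sets -/

section Bounds

variable {K : Matrix (Fin m) (Fin n) ℝ} {X : Matrix (Fin n) (Fin n) ℝ} {a : ℝ}

lemma lambdaMin_trace_add_le (hQ : p.Q.PosDef) (hR : p.R.PosDef) (hX : X.PosSemidef) :
    lambdaMin p.Q * X.trace + lambdaMin p.R * (K * X * Kᵀ).trace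
      ≤ ((p.Q + Kᵀ * p.R * K) * X).trace := by
  have h1 := trace_mul_nonneg (posSemidef_sub_lambdaMin hQ.isHermitian) hX
  have h2 := trace_mul_nonneg (posSemidef_sub_lambdaMin hR.isHermitian)
    (hX.mul_mul_conjTranspose_same K)
  rw [conjTranspose_eq_transpose_of_trivial] at h2
  rw [Matrix.sub_mul, trace_sub, Matrix.smul_mul, trace_smul, Matrix.one_mul, smul_eq_mul] at h1 h2
  have h3 : (Kᵀ * p.R * K * X).trace = (p.R * (K * X * Kᵀ)).trace := by
    rw [Matrix.mul_assoc, Matrix.mul_assoc, trace_mul_comm]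
    simp only [Matrix.mul_assoc]
  rw [Matrix.add_mul, trace_add, h3]
  linarith

lemma trace_le (hn : 0 < n) (hm : 0 < m) (hQ : p.Q.PosDef) (hR : p.R.PosDef) (hX : X.PosSemidef)
    (hc : ((p.Q + Kᵀ * p.R * K) * X).trace ≤ a) :
    X.trace ≤ a / lambdaMin p.Q ∧ (K * X * Kᵀ).trace ≤ a / lambdaMin p.R := by
  have h := (lambdaMin_trace_add_le hQ hR hX).trans hc
  have hq := lambdaMin_pos hn hQ
  have hr := lambdaMin_pos hm hR
  have h1 := mul_nonneg hq.le hX.trace_nonneg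
  have hY := hX.mul_mul_conjTranspose_same K
  rw [conjTranspose_eq_transpose_of_trivial] at hY
  have h2 := mul_nonneg hr.le hY.trace_nonneg
  constructor
  · rw [le_div_iff₀ hq]; linarith
  · rw [le_div_iff₀ hr]; linarith

/-- A Cauchy–Schwarz bound for the form of `X`, when the value of the form at `u` equals that of a
form `Y` of trace at most `a / τ` at the vector `Mᵀ v`. -/
lemma abs_form_le {l : ℕ} {Y : Matrix (Fin l) (Fin l) ℝ} (hX : X.PosSemidef) {τ : ℝ}
    (hY : Y.PosSemidef) (hτ : Y.trace ≤ a / τ) (hτ0 : 0 < τ) (M : Matrix (Fin n) (Fin l) ℝ)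
    (u v : Fin n → ℝ) (hu : u ⬝ᵥ X *ᵥ u = (Mᵀ *ᵥ v) ⬝ᵥ Y *ᵥ (Mᵀ *ᵥ v)) :
    |u ⬝ᵥ X *ᵥ v| ≤
      √(v ⬝ᵥ X *ᵥ v) * ‖WithLp.toLp 2 v‖ * √a * (norm2 M / √τ) := by
  have ha : 0 ≤ a := by
    have := hY.trace_nonneg.trans hτ
    rwa [le_div_iff₀ hτ0, zero_mul] at this
  have hv : 0 ≤ v ⬝ᵥ X *ᵥ v := by simpa using hX.dotProduct_mulVec_nonneg v
  have hM := norm2_nonneg M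
  refine abs_le_of_sq_le_sq ?_ (by positivity)
  refine (PosSemidef.cauchy_schwarz hX u v).trans ?_
  have h1 : u ⬝ᵥ X *ᵥ u ≤ a / τ * (norm2 M * ‖WithLp.toLp 2 v‖) ^ 2 := by
    rw [hu]
    refine (PosSemidef.dotProduct_le_trace hY _).trans ?_
    rw [dotProduct_self_eq_norm_sq]
    have := norm_transpose_mulVec_le M v
    gcongr
  refine (mul_le_mul_of_nonneg_right h1 hv).trans (le_of_eq ?_)
  rw [mul_pow, mul_pow, mul_pow, mul_pow, div_pow, Real.sq_sqrt hv, Real.sq_sqrt ha,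
    Real.sq_sqrt hτ0.le]
  ring

/-- A quantitative lower bound for `X`: testing the Lyapunov equation with `v` gives
`vᵀ Ω v = -2 (Aᵀ v)ᵀ X v + 2 (Kᵀ Bᵀ v)ᵀ X v`, and both terms are controlled by Cauchy–Schwarz for
`X` together with the trace bounds on `X` and `K X Kᵀ`. -/
lemma lambdaMin_mul_sq_le (hn : 0 < n) (hm : 0 < m) (hQ : p.Q.PosDef) (hR : p.R.PosDef)
    (hΩ : p.Ω.PosDef) (hX : X.PosSemidef)
    (hL : p.closedLoop K * X + X * (p.closedLoop K)ᵀ = -p.Ω)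
    (hc : ((p.Q + Kᵀ * p.R * K) * X).trace ≤ a) (v : Fin n → ℝ) :
    lambdaMin p.Ω ^ 2 / 4 * (v ⬝ᵥ v) ^ 2 ≤ (v ⬝ᵥ X *ᵥ v) * (v ⬝ᵥ v) * a *
      (norm2 p.A / √(lambdaMin p.Q) + norm2 p.B / √(lambdaMin p.R)) ^ 2 := by
  obtain ⟨hq, hr⟩ := trace_le hn hm hQ hR hX hc
  have hY := hX.mul_mul_conjTranspose_same K
  rw [conjTranspose_eq_transpose_of_trivial] at hY
  have ha : 0 ≤ a := by
    have := hX.trace_nonneg.trans hq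
    rwa [le_div_iff₀ (lambdaMin_pos hn hQ), zero_mul] at this
  have hv : 0 ≤ v ⬝ᵥ X *ᵥ v := by simpa using hX.dotProduct_mulVec_nonneg v
  have hΩv := lambdaMin_mul_le hΩ.isHermitian v
  have hΩ0 := lambdaMin_pos hn hΩ
  have h1 := abs_form_le hX hX hq (lambdaMin_pos hn hQ) p.A (p.Aᵀ *ᵥ v) v rfl
  have h2 := abs_form_le hX hY hr (lambdaMin_pos hm hR) p.B (Kᵀ *ᵥ (p.Bᵀ *ᵥ v)) v (by
    rw [← mulVec_mulVec, ← mulVec_mulVec, dotProduct_mulVec (p.Bᵀ *ᵥ v), ← mulVec_transpose])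
  have hform : v ⬝ᵥ p.Ω *ᵥ v
      = -2 * ((p.Aᵀ *ᵥ v) ⬝ᵥ X *ᵥ v) + 2 * ((Kᵀ *ᵥ (p.Bᵀ *ᵥ v)) ⬝ᵥ X *ᵥ v) := by
    have hsymm : ∀ u w, u ⬝ᵥ X *ᵥ w = w ⬝ᵥ X *ᵥ u := fun u w => by
      rw [dotProduct_mulVec, ← mulVec_transpose, PosSemidef.symm hX, dotProduct_comm]
    have e1 : v ⬝ᵥ (p.closedLoop K * X) *ᵥ v = ((p.closedLoop K)ᵀ *ᵥ v) ⬝ᵥ X *ᵥ v := by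
      rw [← mulVec_mulVec, dotProduct_mulVec, mulVec_transpose]
    have e2 : v ⬝ᵥ (X * (p.closedLoop K)ᵀ) *ᵥ v = ((p.closedLoop K)ᵀ *ᵥ v) ⬝ᵥ X *ᵥ v := by
      rw [← mulVec_mulVec, hsymm]
    have e3 := congrArg (fun M => v ⬝ᵥ M *ᵥ v) hL
    simp only [add_mulVec, neg_mulVec, dotProduct_add, dotProduct_neg, e1, e2] at e3
    have e4 : (p.closedLoop K)ᵀ *ᵥ v = p.Aᵀ *ᵥ v - Kᵀ *ᵥ (p.Bᵀ *ᵥ v) := by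
      rw [closedLoop, transpose_sub, transpose_mul, sub_mulVec, mulVec_mulVec]
    rw [e4, sub_dotProduct] at e3
    linarith
  set S := norm2 p.A / √(lambdaMin p.Q) + norm2 p.B / √(lambdaMin p.R) with hS
  have hle : lambdaMin p.Ω / 2 * (v ⬝ᵥ v) ≤ √(v ⬝ᵥ X *ᵥ v) * ‖WithLp.toLp 2 v‖ * √a * S := by
    rw [hS, mul_add]
    have := neg_abs_le ((p.Aᵀ *ᵥ v) ⬝ᵥ X *ᵥ v)
    have := le_abs_self ((Kᵀ *ᵥ (p.Bᵀ *ᵥ v)) ⬝ᵥ X *ᵥ v)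
    linarith
  have hvv : 0 ≤ v ⬝ᵥ v := by rw [dotProduct_self_eq_norm_sq]; positivity
  have := pow_le_pow_left₀ (by positivity) hle 2
  rw [mul_pow, mul_pow, mul_pow, mul_pow, Real.sq_sqrt hv, Real.sq_sqrt ha,
    ← dotProduct_self_eq_norm_sq] at this
  linarith

/-- On the sublevel set of level `a`, the covariance is bounded below by `ν / a`. -/
lemma posSemidef_sub_nu_div (hn : 0 < n) (hm : 0 < m) (hQ : p.Q.PosDef) (hR : p.R.PosDef)
    (hΩ : p.Ω.PosDef) (hX : X.PosSemidef)
    (hL : p.closedLoop K * X + X * (p.closedLoop K)ᵀ = -p.Ω)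
    (hc : ((p.Q + Kᵀ * p.R * K) * X).trace ≤ a) :
    0 < a ∧ 0 < p.nu ∧ (X - (p.nu / a) • (1 : Matrix (Fin n) (Fin n) ℝ)).PosSemidef := by
  have h := lambdaMin_mul_sq_le hn hm hQ hR hΩ hX hL hc
  have hΩ0 := lambdaMin_pos hn hΩ
  have hXv : ∀ v, 0 ≤ v ⬝ᵥ X *ᵥ v := fun v => by simpa using hX.dotProduct_mulVec_nonneg v
  set S := norm2 p.A / √(lambdaMin p.Q) + norm2 p.B / √(lambdaMin p.R) with hS
  have hvv : ∀ v : Fin n → ℝ, v ≠ 0 → 0 < v ⬝ᵥ v := fun v hv => by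
    rw [dotProduct_self_eq_norm_sq]
    have : WithLp.toLp 2 v ≠ 0 := by simpa using hv
    have := norm_pos_iff.2 this
    positivity
  have haS : 0 < a ∧ 0 < S ^ 2 := by
    set v : Fin n → ℝ := Pi.single ⟨0, hn⟩ 1
    have hp := hvv v (by simp [v])
    have h2 : 0 < (v ⬝ᵥ X *ᵥ v) * (v ⬝ᵥ v) * a * S ^ 2 := lt_of_lt_of_le (by positivity) (h v)
    have h3 : 0 < (v ⬝ᵥ X *ᵥ v) * (v ⬝ᵥ v) * a := pos_of_mul_pos_left h2 (sq_nonneg S)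
    exact ⟨pos_of_mul_pos_right h3 (mul_nonneg (hXv v) hp.le),
      pos_of_mul_pos_right h2 h3.le⟩
  have hnu : p.nu = lambdaMin p.Ω ^ 2 / 4 * (S ^ 2)⁻¹ := rfl
  obtain ⟨ha, hS2⟩ := haS
  refine ⟨ha, by rw [hnu]; positivity, posSemidef_of_dotProduct ?_ fun v => ?_⟩
  · simp [PosSemidef.symm hX]
  · simp only [sub_mulVec, smul_mulVec, one_mulVec, dotProduct_sub, dotProduct_smul, smul_eq_mul]
    rcases eq_or_ne v 0 with rfl | hv
    · simp
    have hp := hvv v hv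
    have h3 : lambdaMin p.Ω ^ 2 / 4 * (v ⬝ᵥ v) ≤ (v ⬝ᵥ X *ᵥ v) * a * S ^ 2 := by
      refine le_of_mul_le_mul_right ?_ hp
      have := h v
      linarith
    rw [sub_nonneg, hnu, div_mul_eq_mul_div, div_le_iff₀ ha, ← div_eq_mul_inv,
      div_mul_eq_mul_div, div_le_iff₀ hS2]
    exact h3

/-- On the sublevel set of level `a`, the gains are bounded. -/
lemma norm_sq_le (hn : 0 < n) (hm : 0 < m) (hQ : p.Q.PosDef) (hR : p.R.PosDef)
    (hΩ : p.Ω.PosDef) (hX : X.PosSemidef)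
    (hL : p.closedLoop K * X + X * (p.closedLoop K)ᵀ = -p.Ω)
    (hc : ((p.Q + Kᵀ * p.R * K) * X).trace ≤ a) :
    ‖K‖ ^ 2 ≤ a / lambdaMin p.R / (p.nu / a) := by
  obtain ⟨ha, hν, hP⟩ := posSemidef_sub_nu_div hn hm hQ hR hΩ hX hL hc
  have h1 := le_trace_mul_of_sub_posSemidef hP K
  have h2 := (trace_le hn hm hQ hR hX hc).2
  rw [trace_mul_comm, ← Matrix.mul_assoc] at h2
  rw [le_div_iff₀ (by positivity), mul_comm]
  exact h1.trans h2

lemma posDef_of_sub_posSemidef {c : ℝ} (hc : 0 < c)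
    (h : (X - c • (1 : Matrix (Fin n) (Fin n) ℝ)).PosSemidef) : X.PosDef := by
  have := (PosDef.one (n := Fin n) (R := ℝ)).smul hc
  simpa using this.add_posSemidef h

end Bounds

end Params

/-! ### Trace functionals and matrix gradients -/

lemma continuous_norm2 {m n : ℕ} : Continuous (norm2 : Matrix (Fin m) (Fin n) ℝ → ℝ) :=
  (LinearMap.continuous_of_finiteDimensional
    (Matrix.toEuclideanLin.trans LinearMap.toContinuousLinearMap :
      Matrix (Fin m) (Fin n) ℝ ≃ₗ[ℝ] _).toLinearMap).norm

lemma abs_trace_mul_le {m n : ℕ} (M : Matrix (Fin m) (Fin n) ℝ) (N : Matrix (Fin n) (Fin m) ℝ) :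
    |(M * N).trace| ≤ ‖M‖ * ‖N‖ := by
  -- The polynomial `‖s Mᵀ + N‖²` in `s` is nonnegative, so its discriminant is nonpositive.
  have h : ∀ s : ℝ, 0 ≤ ‖M‖ ^ 2 * s ^ 2 + 2 * s * (M * N).trace + ‖N‖ ^ 2 := fun s => by
    have h1 : 0 ≤ ‖s • Mᵀ + N‖ ^ 2 := by positivity
    rw [frobenius_sq, transpose_add, transpose_smul, transpose_transpose, Matrix.add_mul,
      Matrix.mul_add, Matrix.mul_add] at h1
    simp only [Matrix.mul_smul, Matrix.smul_mul, trace_add, trace_smul, smul_eq_mul] at h1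
    have e1 : (M * Mᵀ).trace = ‖M‖ ^ 2 := by rw [frobenius_sq, trace_mul_comm]
    have e2 : (Nᵀ * Mᵀ).trace = (M * N).trace := by rw [← transpose_mul, trace_transpose]
    rw [e1, e2, ← frobenius_sq] at h1
    linarith
  have := discrim_le_zero (a := ‖M‖ ^ 2) (b := 2 * (M * N).trace) (c := ‖N‖ ^ 2)
    (fun s => by have := h s; nlinarith)
  refine abs_le_of_sq_le_sq ?_ (by positivity)
  rw [discrim] at this
  nlinarith

/-- The linear functional `H ↦ trace (Gᵀ H)` on matrices. -/
def traceForm {m n : ℕ} (G : Matrix (Fin m) (Fin n) ℝ) : Matrix (Fin m) (Fin n) ℝ →L[ℝ] ℝ :=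
  LinearMap.toContinuousLinearMap
    { toFun := fun H => (Gᵀ * H).trace
      map_add' := fun H J => by rw [Matrix.mul_add, trace_add]
      map_smul' := fun c H => by rw [Matrix.mul_smul, trace_smul]; rfl }

@[simp]
lemma traceForm_apply {m n : ℕ} (G H : Matrix (Fin m) (Fin n) ℝ) :
    traceForm G H = (Gᵀ * H).trace := rfl

lemma traceForm_injective {m n : ℕ} :
    Function.Injective (traceForm : Matrix (Fin m) (Fin n) ℝ → _) := by
  intro G H h
  have h1 : ((G - H)ᵀ * (G - H)).trace = 0 := by
    have := DFunLike.congr_fun h (G - H)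
    simp only [traceForm_apply] at this
    rw [transpose_sub, Matrix.sub_mul, trace_sub, this, sub_self]
  rw [← frobenius_sq] at h1
  simpa [sub_eq_zero] using h1

lemma hasMatrixGradientAt_iff {m n : ℕ} {φ : Matrix (Fin m) (Fin n) ℝ → ℝ}
    {G K : Matrix (Fin m) (Fin n) ℝ} :
    HasMatrixGradientAt φ G K ↔ HasFDerivAt φ (traceForm G) K := by
  constructor
  · rintro ⟨φ', h, hφ⟩
    have : φ' = traceForm G := ContinuousLinearMap.ext hφ
    rw [this] at h
    exact h
  · exact fun h => ⟨traceForm G, h, fun H => rfl⟩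

namespace Params

variable {n m : ℕ} {p : Params n m}

/-! ### Regularity and the gradient of the cost -/

lemma closedLoop_mul_X_add (hn : 0 < n) {K : Matrix (Fin m) (Fin n) ℝ} (hK : K ∈ p.stabilizing) :
    p.closedLoop K * p.X K + p.X K * (p.closedLoop K)ᵀ = -p.Ω := by
  simpa using lyapunovMap_X hn hK

lemma X_posDef (hn : 0 < n) (hm : 0 < m) (hQ : p.Q.PosDef) (hR : p.R.PosDef) (hΩ : p.Ω.PosDef)
    {K : Matrix (Fin m) (Fin n) ℝ} (hK : K ∈ p.stabilizing) : (p.X K).PosDef := by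
  obtain ⟨ha, hν, h⟩ := posSemidef_sub_nu_div hn hm hQ hR hΩ (X_posSemidef hn hΩ hK)
    (closedLoop_mul_X_add hn hK) (le_refl (p.costValue K))
  exact posDef_of_sub_posSemidef (div_pos hν ha) h

lemma continuous_closedLoop : Continuous p.closedLoop := by
  refine continuous_const.sub ?_
  exact LinearMap.continuous_of_finiteDimensional (mulLeftLinearMap (Fin n) ℝ p.B)

/-- Stability is an open condition: the covariance at a stabilizing gain remains a Lyapunov
certificate at nearby gains. -/
lemma isOpen_stabilizing (hn : 0 < n) (hm : 0 < m) (hQ : p.Q.PosDef) (hR : p.R.PosDef)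
    (hΩ : p.Ω.PosDef) : IsOpen p.stabilizing := by
  refine isOpen_iff_mem_nhds.2 fun K hK => ?_
  have hX := X_posDef hn hm hQ hR hΩ hK
  have hXs := PosSemidef.symm hX.posSemidef
  set g : Matrix (Fin m) (Fin n) ℝ → Matrix (Fin n) (Fin n) ℝ := fun L =>
    p.Ω + (p.closedLoop L * p.X K + p.X K * (p.closedLoop L)ᵀ) with hg
  have hgc : Continuous g := by
    have h1 : Continuous fun L => (p.closedLoop L)ᵀ :=
      (LinearMap.continuous_of_finiteDimensional
        (Matrix.transposeLinearEquiv (Fin n) (Fin n) ℝ ℝ).toLinearMap).comp continuous_closedLoop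
    exact continuous_const.add ((continuous_closedLoop.mul continuous_const).add
      (continuous_const.mul h1))
  have hgK : norm2 (g K) = 0 := by
    have : g K = 0 := by simp only [hg, closedLoop_mul_X_add hn hK, add_neg_cancel]
    rw [this]
    simp [norm2]
  have hev : ∀ᶠ L in 𝓝 K, norm2 (g L) < lambdaMin p.Ω := by
    refine (continuous_norm2.comp hgc).continuousAt.eventually_lt continuousAt_const ?_
    rw [Function.comp_apply, hgK]
    exact lambdaMin_pos hn hΩ
  filter_upwards [hev] with L hL
  have hs : (g L)ᵀ = g L := by
    simp only [hg, transpose_add, transpose_mul, hXs, PosSemidef.symm hΩ.posSemidef,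
      transpose_transpose]
    rw [add_comm (p.X K * _)]
  have hW : (p.Ω - g L).PosDef := by
    refine posDef_of_sub_posSemidef (sub_pos.2 hL) ?_
    have := (posSemidef_sub_lambdaMin hΩ.isHermitian).add (posSemidef_smul_one_sub hs)
    convert this using 1
    rw [sub_smul]
    abel
  exact isHurwitz_of_lyapunov hX hW (by simp [hg])

lemma contDiff_closedLoop : ContDiff ℝ 1 p.closedLoop := by
  refine contDiff_const.sub ?_
  exact (LinearMap.toContinuousLinearMap (mulLeftLinearMap (Fin n) ℝ p.B)).contDiff

lemma contDiffAt_X (hn : 0 < n) (hm : 0 < m) (hQ : p.Q.PosDef) (hR : p.R.PosDef)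
    (hΩ : p.Ω.PosDef) {K : Matrix (Fin m) (Fin n) ℝ} (hK : K ∈ p.stabilizing) :
    ContDiffAt ℝ 1 p.X K := by
  have h1 : ContDiffAt ℝ 1 (fun L => lyapunovMap n (p.closedLoop L)) K :=
    ((LinearMap.toContinuousLinearMap (lyapunovMap n)).contDiff.comp
      contDiff_closedLoop).contDiffAt
  obtain ⟨u, hu⟩ := IsHurwitz.isUnit_lyapunovMap hn hK
  have h2 : ContDiffAt ℝ 1 Ring.inverse (lyapunovMap n (p.closedLoop K)) := by
    rw [← hu]
    exact contDiffAt_ringInverse ℝ u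
  have h3 := (h2.comp K h1).clm_apply (contDiffAt_const (c := -p.Ω))
  refine h3.congr_of_eventuallyEq ?_
  filter_upwards [(isOpen_stabilizing hn hm hQ hR hΩ).mem_nhds hK] with L hL
  exact X_eq_inverse hn hL

lemma contDiff_transpose {k l : ℕ} :
    ContDiff ℝ 1 (Matrix.transpose : Matrix (Fin k) (Fin l) ℝ → _) :=
  (LinearMap.toContinuousLinearMap
    (Matrix.transposeLinearEquiv (Fin k) (Fin l) ℝ ℝ).toLinearMap).contDiff

/-- Multiplication of rectangular matrices as a bounded bilinear map. -/
def mulBilin (j k l : ℕ) : Matrix (Fin j) (Fin k) ℝ →L[ℝ] Matrix (Fin k) (Fin l) ℝ →L[ℝ]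
    Matrix (Fin j) (Fin l) ℝ :=
  LinearMap.mkContinuous₂ (LinearMap.mk₂ ℝ (fun M N => M * N) Matrix.add_mul
    (fun c M N => Matrix.smul_mul c M N) Matrix.mul_add (fun c M N => Matrix.mul_smul M c N)) 1
    (fun M N => by simpa using frobenius_norm_mul M N)

lemma _root_.ContDiffAt.matrix_mul {E : Type*} [NormedAddCommGroup E] [NormedSpace ℝ E]
    {j k l : ℕ} {f : E → Matrix (Fin j) (Fin k) ℝ} {g : E → Matrix (Fin k) (Fin l) ℝ} {x : E}
    (hf : ContDiffAt ℝ 1 f x) (hg : ContDiffAt ℝ 1 g x) :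
    ContDiffAt ℝ 1 (fun y => f y * g y) x :=
  ((mulBilin j k l).contDiff.contDiffAt.comp x hf).clm_apply hg

lemma contDiffAt_costToGo (hn : 0 < n) {K : Matrix (Fin m) (Fin n) ℝ} (hK : K ∈ p.stabilizing) :
    ContDiffAt ℝ 1 p.costToGo K := by
  have h1 : ContDiffAt ℝ 1 (fun L => lyapunovMap n (p.closedLoop L)ᵀ) K :=
    ((LinearMap.toContinuousLinearMap (lyapunovMap n)).contDiff.comp
      (contDiff_transpose.comp contDiff_closedLoop)).contDiffAt
  obtain ⟨u, hu⟩ := IsHurwitz.isUnit_lyapunovMap hn (IsHurwitz.transpose hK)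
  have h2 : ContDiffAt ℝ 1 Ring.inverse (lyapunovMap n (p.closedLoop K)ᵀ) := by
    rw [← hu]
    exact contDiffAt_ringInverse ℝ u
  have h4 : ContDiffAt ℝ 1 (fun L : Matrix (Fin m) (Fin n) ℝ => -(p.Q + Lᵀ * p.R * L)) K :=
    (contDiffAt_const.add ((contDiff_transpose.contDiffAt.matrix_mul contDiffAt_const).matrix_mul
      contDiffAt_id)).neg
  exact (h2.comp K h1).clm_apply h4

variable (p) in
/-- The gradient `2 E(K) X(K)` of the cost at a stabilizing gain. -/
def grad (K : Matrix (Fin m) (Fin n) ℝ) : Matrix (Fin m) (Fin n) ℝ :=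
  (2 : ℝ) • (p.gradFactor K * p.X K)

lemma contDiffAt_grad (hn : 0 < n) (hm : 0 < m) (hQ : p.Q.PosDef) (hR : p.R.PosDef)
    (hΩ : p.Ω.PosDef) {K : Matrix (Fin m) (Fin n) ℝ} (hK : K ∈ p.stabilizing) :
    ContDiffAt ℝ 1 p.grad K := by
  have h1 : ContDiffAt ℝ 1 p.gradFactor K :=
    (contDiffAt_const.matrix_mul contDiffAt_id).sub
      (contDiffAt_const.matrix_mul (contDiffAt_costToGo hn hK))
  exact (h1.matrix_mul (contDiffAt_X hn hm hQ hR hΩ hK)).const_smul (2 : ℝ)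

/-- The increment formula `costValue_sub` and continuity of `X` identify the derivative. -/
lemma hasFDerivAt_costValue (hn : 0 < n) (hm : 0 < m) (hQ : p.Q.PosDef) (hR : p.R.PosDef)
    (hΩ : p.Ω.PosDef) {K : Matrix (Fin m) (Fin n) ℝ} (hK : K ∈ p.stabilizing) :
    HasFDerivAt p.costValue (traceForm (p.grad K)) K := by
  set E := p.gradFactor K with hE
  have hXc : ContinuousAt p.X K := (contDiffAt_X hn hm hQ hR hΩ hK).continuousAt
  have hXs : (p.X K)ᵀ = p.X K := PosSemidef.symm (X_posSemidef hn hΩ hK)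
  set r : Matrix (Fin m) (Fin n) ℝ → ℝ := fun L =>
    ‖L - K‖ * ‖p.R‖ * ‖p.X L‖ + 2 * ‖E‖ * ‖p.X L - p.X K‖ with hr
  have hr0 : Tendsto r (𝓝 K) (𝓝 0) := by
    have h1 : ContinuousAt r K := by
      have hid : ContinuousAt (fun L : Matrix (Fin m) (Fin n) ℝ => L - K) K :=
        (continuous_id.sub continuous_const).continuousAt
      exact ((hid.norm.mul continuousAt_const).mul hXc.norm).add
        (continuousAt_const.mul (hXc.sub continuousAt_const).norm)
    have h2 : r K = 0 := by simp [hr]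
    have h3 : Tendsto r (𝓝 K) (𝓝 (r K)) := h1
    rwa [h2] at h3
  refine HasFDerivAt.of_isLittleO (Asymptotics.isLittleO_iff.2 fun c hc => ?_)
  filter_upwards [(isOpen_stabilizing hn hm hQ hR hΩ).mem_nhds hK, hr0.eventually_lt_const hc]
    with L hL hrL
  set D := L - K with hD
  have e : p.costValue L - p.costValue K - traceForm (p.grad K) D
      = (Dᵀ * p.R * D * p.X L).trace + ((Dᵀ * E + Eᵀ * D) * (p.X L - p.X K)).trace := by
    rw [costValue_sub hn hQ hR hK hL, traceForm_apply, grad, ← hD, ← hE, transpose_smul]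
    clear_value D E
    rw [Matrix.smul_mul, trace_smul, transpose_mul, hXs, Matrix.mul_sub, trace_sub, Matrix.add_mul,
      Matrix.add_mul, trace_add, trace_add, Matrix.add_mul _ _ (p.X L), trace_add,
      Matrix.add_mul _ _ (p.X K), trace_add]
    have e1 : (p.X K * Eᵀ * D).trace = (Eᵀ * D * p.X K).trace := by
      rw [Matrix.mul_assoc, trace_mul_comm]
    have e2 : (Dᵀ * E * p.X K).trace = (Eᵀ * D * p.X K).trace := by
      rw [← trace_transpose, transpose_mul, transpose_mul, transpose_transpose, hXs,
        trace_mul_comm]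
    rw [e1, e2, smul_eq_mul]
    ring
  rw [e, Real.norm_eq_abs]
  have n1 : ‖Dᵀ * p.R * D‖ ≤ ‖D‖ * ‖p.R‖ * ‖D‖ := by
    refine (frobenius_norm_mul _ _).trans ?_
    refine mul_le_mul_of_nonneg_right ((frobenius_norm_mul _ _).trans ?_) (norm_nonneg _)
    rw [frobenius_norm_transpose]
  have n2 : ‖Dᵀ * E + Eᵀ * D‖ ≤ 2 * ‖E‖ * ‖D‖ := by
    refine (norm_add_le _ _).trans ?_
    have h1 := frobenius_norm_mul Dᵀ E
    have h2 := frobenius_norm_mul Eᵀ D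
    rw [frobenius_norm_transpose] at h1 h2
    linarith
  have b1 := (abs_trace_mul_le (Dᵀ * p.R * D) (p.X L)).trans
    (mul_le_mul_of_nonneg_right n1 (norm_nonneg _))
  have b2 := (abs_trace_mul_le (Dᵀ * E + Eᵀ * D) (p.X L - p.X K)).trans
    (mul_le_mul_of_nonneg_right n2 (norm_nonneg _))
  calc _ ≤ ‖D‖ * ‖p.R‖ * ‖D‖ * ‖p.X L‖ + 2 * ‖E‖ * ‖D‖ * ‖p.X L - p.X K‖ :=
        (abs_add_le _ _).trans (add_le_add b1 b2)
    _ = r L * ‖D‖ := by simp only [hr, ← hD]; ring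
    _ ≤ c * ‖D‖ := mul_le_mul_of_nonneg_right hrL.le (norm_nonneg _)

lemma hasMatrixGradientAt_costValue_iff (hn : 0 < n) (hm : 0 < m) (hQ : p.Q.PosDef)
    (hR : p.R.PosDef) (hΩ : p.Ω.PosDef) {K G : Matrix (Fin m) (Fin n) ℝ}
    (hK : K ∈ p.stabilizing) : HasMatrixGradientAt p.costValue G K ↔ G = p.grad K := by
  have h := hasFDerivAt_costValue hn hm hQ hR hΩ hK
  rw [hasMatrixGradientAt_iff]
  exact ⟨fun h' => traceForm_injective (h'.unique h), fun e => e ▸ h⟩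

/-! ### Compact sublevel sets and the optimal gain -/

variable (p) in
/-- The sublevel set `{K | f(K) ≤ a}` of the cost, made of stabilizing gains. -/
def sublevel (a : ℝ) : Set (Matrix (Fin m) (Fin n) ℝ) :=
  {K | K ∈ p.stabilizing ∧ p.costValue K ≤ a}

variable (p) in
/-- The gains of the sublevel set paired with their covariance `X`, described by closed conditions
only: stability follows from the uniform lower bound `X ≥ ν / a`. -/
def sublevelPairs (a : ℝ) : Set (Matrix (Fin m) (Fin n) ℝ × Matrix (Fin n) (Fin n) ℝ) :=
  {z | z.2ᵀ = z.2 ∧ (∀ v, p.nu / a * (v ⬝ᵥ v) ≤ v ⬝ᵥ z.2 *ᵥ v) ∧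
    p.closedLoop z.1 * z.2 + z.2 * (p.closedLoop z.1)ᵀ = -p.Ω ∧
    ((p.Q + z.1ᵀ * p.R * z.1) * z.2).trace ≤ a}

lemma isClosed_sublevelPairs (a : ℝ) : IsClosed (p.sublevelPairs a) := by
  have ht : ∀ k l : ℕ, Continuous (Matrix.transpose : Matrix (Fin k) (Fin l) ℝ → _) :=
    fun k l => contDiff_transpose.continuous
  have htr : Continuous (Matrix.trace : Matrix (Fin n) (Fin n) ℝ → ℝ) :=
    LinearMap.continuous_of_finiteDimensional (Matrix.traceLinearMap (Fin n) ℝ ℝ)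
  have hq : ∀ v : Fin n → ℝ, Continuous fun M : Matrix (Fin n) (Fin n) ℝ => v ⬝ᵥ M *ᵥ v :=
    fun v => (vecForm v).continuous
  have hcl : Continuous fun z : Matrix (Fin m) (Fin n) ℝ × Matrix (Fin n) (Fin n) ℝ =>
      p.closedLoop z.1 := continuous_closedLoop.comp continuous_fst
  have hmul : ∀ j k l : ℕ, Continuous fun z : Matrix (Fin j) (Fin k) ℝ × Matrix (Fin k) (Fin l) ℝ =>
      z.1 * z.2 := fun j k l => ((mulBilin j k l).continuous.comp continuous_fst).clm_apply
        continuous_snd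
  have h1 : IsClosed {z : Matrix (Fin m) (Fin n) ℝ × Matrix (Fin n) (Fin n) ℝ | z.2ᵀ = z.2} :=
    isClosed_eq ((ht _ _).comp continuous_snd) continuous_snd
  have h2 : IsClosed {z : Matrix (Fin m) (Fin n) ℝ × Matrix (Fin n) (Fin n) ℝ |
      ∀ v, p.nu / a * (v ⬝ᵥ v) ≤ v ⬝ᵥ z.2 *ᵥ v} := by
    rw [Set.ofPred_forall]
    exact isClosed_iInter fun v => isClosed_le continuous_const ((hq v).comp continuous_snd)
  have h3 : IsClosed {z : Matrix (Fin m) (Fin n) ℝ × Matrix (Fin n) (Fin n) ℝ |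
      p.closedLoop z.1 * z.2 + z.2 * (p.closedLoop z.1)ᵀ = -p.Ω} :=
    isClosed_eq ((hcl.mul continuous_snd).add (continuous_snd.mul ((ht _ _).comp hcl)))
      continuous_const
  have h4 : IsClosed {z : Matrix (Fin m) (Fin n) ℝ × Matrix (Fin n) (Fin n) ℝ |
      ((p.Q + z.1ᵀ * p.R * z.1) * z.2).trace ≤ a} := by
    have h : Continuous fun z : Matrix (Fin m) (Fin n) ℝ × Matrix (Fin n) (Fin n) ℝ =>
        z.1ᵀ * p.R * z.1 :=
      (hmul _ _ _).comp (((hmul _ _ _).comp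
        (((ht _ _).comp continuous_fst).prodMk continuous_const)).prodMk continuous_fst)
    exact isClosed_le (htr.comp ((continuous_const.add h).mul continuous_snd)) continuous_const
  exact h1.inter (h2.inter (h3.inter h4))

/-- For positive `ν` and `a`, the sublevel set is the projection of the pairs. -/
lemma mem_sublevelPairs_iff (hn : 0 < n) (hm : 0 < m) (hQ : p.Q.PosDef) (hR : p.R.PosDef)
    (hΩ : p.Ω.PosDef) {a : ℝ} (h0 : 0 < p.nu / a) {K : Matrix (Fin m) (Fin n) ℝ}
    {X : Matrix (Fin n) (Fin n) ℝ} :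
    (K, X) ∈ p.sublevelPairs a ↔ K ∈ p.sublevel a ∧ X = p.X K := by
  constructor
  · rintro ⟨h1, h2, h3, h4⟩
    have hX : X.PosDef := by
      refine posDef_of_sub_posSemidef h0 (posSemidef_of_dotProduct (by simpa using h1) fun v => ?_)
      simpa [sub_mulVec, smul_mulVec, dotProduct_sub] using h2 v
    have hK : K ∈ p.stabilizing := isHurwitz_of_lyapunov hX hΩ h3
    have hXK : X = p.X K := by
      refine IsHurwitz.lyapunovMap_injective hn hK ?_
      rw [lyapunovMap_X hn hK, lyapunovMap_apply]
      exact h3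
    refine ⟨⟨hK, ?_⟩, hXK⟩
    rw [costValue, ← hXK]
    exact h4
  · rintro ⟨⟨hK, hc⟩, rfl⟩
    have hX := X_posSemidef hn hΩ hK
    obtain ⟨-, -, h⟩ := posSemidef_sub_nu_div hn hm hQ hR hΩ hX (closedLoop_mul_X_add hn hK) hc
    refine ⟨PosSemidef.symm hX, fun v => ?_, closedLoop_mul_X_add hn hK, hc⟩
    simpa [sub_mulVec, smul_mulVec, dotProduct_sub] using h.dotProduct_mulVec_nonneg v

lemma level_pos_and_nu_pos (hn : 0 < n) (hm : 0 < m) (hQ : p.Q.PosDef) (hR : p.R.PosDef)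
    (hΩ : p.Ω.PosDef) {a : ℝ} {K : Matrix (Fin m) (Fin n) ℝ} (hK : K ∈ p.sublevel a) :
    0 < a ∧ 0 < p.nu := by
  obtain ⟨h1, h2, -⟩ := posSemidef_sub_nu_div hn hm hQ hR hΩ (X_posSemidef hn hΩ hK.1)
    (closedLoop_mul_X_add hn hK.1) hK.2
  exact ⟨h1, h2⟩

lemma isCompact_sublevel (hn : 0 < n) (hm : 0 < m) (hQ : p.Q.PosDef) (hR : p.R.PosDef)
    (hΩ : p.Ω.PosDef) (a : ℝ) : IsCompact (p.sublevel a) := by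
  rcases (p.sublevel a).eq_empty_or_nonempty with he | ⟨K₀, hK₀⟩
  · rw [he]
    exact isCompact_empty
  obtain ⟨ha, hν⟩ := level_pos_and_nu_pos hn hm hQ hR hΩ hK₀
  have hiff := fun K X => mem_sublevelPairs_iff hn hm hQ hR hΩ (div_pos hν ha) (K := K) (X := X)
  have hb : Bornology.IsBounded (p.sublevelPairs a) := by
    refine isBounded_iff_forall_norm_le.2
      ⟨max √(a / lambdaMin p.R / (p.nu / a)) (a / lambdaMin p.Q), ?_⟩
    rintro ⟨K, X⟩ hz
    obtain ⟨⟨hK, hc⟩, rfl⟩ := (hiff K X).1 hz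
    have hX := X_posSemidef hn hΩ hK
    refine max_le_max ?_ ?_
    · exact Real.le_sqrt_of_sq_le (norm_sq_le hn hm hQ hR hΩ hX (closedLoop_mul_X_add hn hK) hc)
    · exact (frobenius_norm_le_trace hX).trans (trace_le hn hm hQ hR hX hc).1
  have hcomp : IsCompact (p.sublevelPairs a) :=
    Metric.isCompact_of_isClosed_isBounded (isClosed_sublevelPairs a) hb
  have himg : p.sublevel a = Prod.fst '' p.sublevelPairs a := by
    ext K
    constructor
    · exact fun hK => ⟨(K, p.X K), (hiff _ _).2 ⟨hK, rfl⟩, rfl⟩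
    · rintro ⟨⟨K', X⟩, hz, rfl⟩
      exact ((hiff _ _).1 hz).1
  rw [himg]
  exact hcomp.image continuous_fst

lemma exists_minimizer (hn : 0 < n) (hm : 0 < m) (hQ : p.Q.PosDef) (hR : p.R.PosDef)
    (hΩ : p.Ω.PosDef) {K₀ : Matrix (Fin m) (Fin n) ℝ} (hK₀ : K₀ ∈ p.stabilizing) :
    ∃ K ∈ p.stabilizing, ∀ L ∈ p.stabilizing, p.costValue K ≤ p.costValue L := by
  have hc : ContinuousOn p.costValue (p.sublevel (p.costValue K₀)) := fun K hK =>
    (hasFDerivAt_costValue hn hm hQ hR hΩ hK.1).continuousAt.continuousWithinAt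
  obtain ⟨K, hK, hmin⟩ := (isCompact_sublevel hn hm hQ hR hΩ (p.costValue K₀)).exists_isMinOn
    ⟨K₀, hK₀, le_rfl⟩ hc
  refine ⟨K, hK.1, fun L hL => ?_⟩
  rcases le_total (p.costValue L) (p.costValue K₀) with h | h
  · exact hmin ⟨hL, h⟩
  · exact hK.2.trans h

/-! ### Gradient dominance -/

/-- Since `∇f = 2 E X` and `X ≥ ν / a`, the factor `E` is controlled by the gradient. -/
lemma norm_gradFactor_sq_le (hn : 0 < n) (hm : 0 < m) (hQ : p.Q.PosDef) (hR : p.R.PosDef)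
    (hΩ : p.Ω.PosDef) {a : ℝ} {K : Matrix (Fin m) (Fin n) ℝ} (hK : K ∈ p.sublevel a) :
    4 * (p.nu / a) ^ 2 * ‖p.gradFactor K‖ ^ 2 ≤ ‖p.grad K‖ ^ 2 := by
  obtain ⟨ha, hν, h⟩ := posSemidef_sub_nu_div hn hm hQ hR hΩ (X_posSemidef hn hΩ hK.1)
    (closedLoop_mul_X_add hn hK.1) hK.2
  have := sq_mul_le_norm_mul_sq (div_pos hν ha).le h (p.gradFactor K)
  rw [grad, norm_smul, mul_pow, Real.norm_ofNat]
  linarith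

/-- The gap between two values of the cost is at most a multiple of `‖E(K)‖²`, by completing the
square in the increment formula. -/
lemma costValue_sub_le (hn : 0 < n) (hm : 0 < m) (hQ : p.Q.PosDef) (hR : p.R.PosDef)
    (hΩ : p.Ω.PosDef) {a : ℝ} {K L : Matrix (Fin m) (Fin n) ℝ} (hK : K ∈ p.stabilizing)
    (hL : L ∈ p.sublevel a) :
    lambdaMin p.R * lambdaMin p.Q * (p.costValue K - p.costValue L)
      ≤ a * ‖p.gradFactor K‖ ^ 2 := by
  set E := p.gradFactor K with hE
  set r := lambdaMin p.R with hr
  have hr0 : 0 < r := lambdaMin_pos hm hR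
  have hq0 := lambdaMin_pos hn hQ
  have hX := X_posSemidef hn hΩ hL.1
  have hsub := costValue_sub hn hQ hR hK hL.1
  rw [← hE] at hsub
  set D := L - K with hD
  clear_value D E
  have h1 : 0 ≤ ((Dᵀ * p.R * D - r • (Dᵀ * D)) * p.X L).trace := by
    refine trace_mul_nonneg ?_ hX
    have := (posSemidef_sub_lambdaMin hR.isHermitian).conjTranspose_mul_mul_same D
    rw [conjTranspose_eq_transpose_of_trivial] at this
    convert this using 1
    rw [Matrix.mul_sub, Matrix.sub_mul, Matrix.mul_smul, Matrix.smul_mul, Matrix.mul_one]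
  have h2 : 0 ≤ (((r • D + E)ᵀ * (r • D + E)) * p.X L).trace := by
    refine trace_mul_nonneg ?_ hX
    simpa [conjTranspose_eq_transpose_of_trivial] using
      posSemidef_conjTranspose_mul_self (r • D + E)
  have h3 : (Eᵀ * E * p.X L).trace ≤ (p.X L).trace * ‖E‖ ^ 2 :=
    trace_mul_le_of_sub_posSemidef (posSemidef_trace_smul_sub hX) E
  have h4 := (trace_le hn hm hQ hR hX hL.2).1
  simp only [transpose_add, transpose_smul, Matrix.add_mul, Matrix.mul_add, Matrix.sub_mul,
    Matrix.smul_mul, Matrix.mul_smul, trace_add, trace_sub, trace_smul, smul_eq_mul] at h1 h2 hsub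
  have h5 : r * (p.costValue K - p.costValue L) ≤ (Eᵀ * E * p.X L).trace := by nlinarith
  rw [le_div_iff₀ hq0] at h4
  have h6 : 0 ≤ ‖E‖ ^ 2 := by positivity
  calc r * lambdaMin p.Q * (p.costValue K - p.costValue L)
      = r * (p.costValue K - p.costValue L) * lambdaMin p.Q := by ring
    _ ≤ (p.X L).trace * ‖E‖ ^ 2 * lambdaMin p.Q :=
        mul_le_mul_of_nonneg_right (h5.trans h3) hq0.le
    _ = (p.X L).trace * lambdaMin p.Q * ‖E‖ ^ 2 := by ring
    _ ≤ a * ‖E‖ ^ 2 := mul_le_mul_of_nonneg_right h4 h6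

variable (p) in
/-- A rate `4 λ_min(R) λ_min(Q) ν² / a³` of exponential decay on the sublevel set of level `a`. -/
def gradientRate (a : ℝ) : ℝ :=
  4 * lambdaMin p.R * lambdaMin p.Q * p.nu ^ 2 / a ^ 3

/-- The Polyak–Łojasiewicz inequality on a sublevel set. -/
lemma gradientRate_mul_le (hn : 0 < n) (hm : 0 < m) (hQ : p.Q.PosDef) (hR : p.R.PosDef)
    (hΩ : p.Ω.PosDef) {a : ℝ} {K L : Matrix (Fin m) (Fin n) ℝ} (hK : K ∈ p.sublevel a)
    (hL : L ∈ p.sublevel a) :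
    p.gradientRate a * (p.costValue K - p.costValue L) ≤ ‖p.grad K‖ ^ 2 := by
  obtain ⟨ha, hν⟩ := level_pos_and_nu_pos hn hm hQ hR hΩ hK
  have h1 := norm_gradFactor_sq_le hn hm hQ hR hΩ hK
  have h2 := costValue_sub_le hn hm hQ hR hΩ hK.1 hL
  refine le_trans ?_ h1
  have h3 : p.gradientRate a * (p.costValue K - p.costValue L)
      = 4 * p.nu ^ 2 / a ^ 3
        * (lambdaMin p.R * lambdaMin p.Q * (p.costValue K - p.costValue L)) := by
    rw [gradientRate]; ring
  rw [h3]
  refine (mul_le_mul_of_nonneg_left h2 (by positivity)).trans (le_of_eq ?_)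
  field_simp

/-! ### Quadratic bounds around the optimal gain -/

section Optimal

variable {Ks K : Matrix (Fin m) (Fin n) ℝ} {a : ℝ}

lemma gradFactor_eq_zero (hn : 0 < n) (hm : 0 < m) (hQ : p.Q.PosDef) (hR : p.R.PosDef)
    (hΩ : p.Ω.PosDef) (hKs : Ks ∈ p.stabilizing)
    (hmin : ∀ L ∈ p.stabilizing, p.costValue Ks ≤ p.costValue L) : p.gradFactor Ks = 0 := by
  have hloc : IsLocalMin p.costValue Ks := by
    filter_upwards [(isOpen_stabilizing hn hm hQ hR hΩ).mem_nhds hKs] with L hL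
    exact hmin L hL
  have h0 := hloc.hasFDerivAt_eq_zero (hasFDerivAt_costValue hn hm hQ hR hΩ hKs)
  have hg : p.grad Ks = 0 := by
    refine traceForm_injective (h0.trans ?_)
    ext H
    simp
  have hK : Ks ∈ p.sublevel (p.costValue Ks) := ⟨hKs, le_rfl⟩
  obtain ⟨ha, hν⟩ := level_pos_and_nu_pos hn hm hQ hR hΩ hK
  have h1 := norm_gradFactor_sq_le hn hm hQ hR hΩ hK
  rw [hg, norm_zero, zero_pow two_ne_zero] at h1
  have h2 : 0 < 4 * (p.nu / p.costValue Ks) ^ 2 := by positivity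
  have h3 : ‖p.gradFactor Ks‖ ^ 2 ≤ 0 := by
    by_contra! h
    exact absurd h1 (not_le.2 (mul_pos h2 h))
  simpa using le_antisymm h3 (by positivity)

/-- At a critical gain the increment formula is a pure quadratic form in `K - K⋆`. -/
lemma costValue_sub_of_gradFactor (hn : 0 < n) (hQ : p.Q.PosDef) (hR : p.R.PosDef)
    (hKs : Ks ∈ p.stabilizing) (hE : p.gradFactor Ks = 0) (hK : K ∈ p.stabilizing) :
    p.costValue K - p.costValue Ks = (p.R * ((K - Ks) * p.X K * (K - Ks)ᵀ)).trace := by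
  rw [costValue_sub hn hQ hR hKs hK, hE]
  generalize K - Ks = D
  rw [transpose_zero, Matrix.mul_zero, Matrix.zero_mul, add_zero, add_zero, Matrix.mul_assoc,
    Matrix.mul_assoc, trace_mul_comm]
  simp only [Matrix.mul_assoc]

lemma mul_norm_sub_sq_le (hn : 0 < n) (hm : 0 < m) (hQ : p.Q.PosDef) (hR : p.R.PosDef)
    (hΩ : p.Ω.PosDef) (hKs : Ks ∈ p.stabilizing) (hE : p.gradFactor Ks = 0)
    (hK : K ∈ p.sublevel a) :
    lambdaMin p.R * (p.nu / a) * ‖K - Ks‖ ^ 2 ≤ p.costValue K - p.costValue Ks := by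
  have hX := X_posSemidef hn hΩ hK.1
  obtain ⟨ha, hν, h⟩ := posSemidef_sub_nu_div hn hm hQ hR hΩ hX (closedLoop_mul_X_add hn hK.1) hK.2
  rw [costValue_sub_of_gradFactor hn hQ hR hKs hE hK.1]
  have h1 := trace_mul_nonneg (posSemidef_sub_lambdaMin hR.isHermitian)
    (hX.mul_mul_conjTranspose_same (K - Ks))
  rw [conjTranspose_eq_transpose_of_trivial, Matrix.sub_mul, trace_sub, Matrix.smul_mul, trace_smul,
    Matrix.one_mul, smul_eq_mul, trace_mul_comm (_ * _) (K - Ks)ᵀ,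
    ← Matrix.mul_assoc (K - Ks)ᵀ] at h1
  have h2 := le_trace_mul_of_sub_posSemidef h (K - Ks)
  have := mul_le_mul_of_nonneg_left h2 (lambdaMin_pos hm hR).le
  linarith

lemma costValue_sub_le_mul_norm_sq (hn : 0 < n) (hm : 0 < m) (hQ : p.Q.PosDef) (hR : p.R.PosDef)
    (hΩ : p.Ω.PosDef) (hKs : Ks ∈ p.stabilizing) (hE : p.gradFactor Ks = 0)
    (hK : K ∈ p.sublevel a) :
    p.costValue K - p.costValue Ks ≤ norm2 p.R * (a / lambdaMin p.Q) * ‖K - Ks‖ ^ 2 := by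
  have hX := X_posSemidef hn hΩ hK.1
  rw [costValue_sub_of_gradFactor hn hQ hR hKs hE hK.1]
  have h1 := trace_mul_nonneg (posSemidef_smul_one_sub (PosSemidef.symm hR.posSemidef))
    (hX.mul_mul_conjTranspose_same (K - Ks))
  rw [conjTranspose_eq_transpose_of_trivial, Matrix.sub_mul, trace_sub, Matrix.smul_mul, trace_smul,
    Matrix.one_mul, smul_eq_mul, trace_mul_comm (_ * _) (K - Ks)ᵀ,
    ← Matrix.mul_assoc (K - Ks)ᵀ] at h1
  have h2 := trace_mul_le_of_sub_posSemidef (posSemidef_trace_smul_sub hX) (K - Ks)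
  have h3 := mul_le_mul_of_nonneg_left
    (h2.trans (mul_le_mul_of_nonneg_right (trace_le hn hm hQ hR hX hK.2).1 (by positivity)))
    (norm2_nonneg p.R)
  linarith

lemma eq_of_costValue_le (hn : 0 < n) (hm : 0 < m) (hQ : p.Q.PosDef) (hR : p.R.PosDef)
    (hΩ : p.Ω.PosDef) (hKs : Ks ∈ p.stabilizing) (hE : p.gradFactor Ks = 0)
    (hK : K ∈ p.stabilizing) (hle : p.costValue K ≤ p.costValue Ks) : K = Ks := by
  have hKa : K ∈ p.sublevel (p.costValue K) := ⟨hK, le_rfl⟩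
  obtain ⟨ha, hν⟩ := level_pos_and_nu_pos hn hm hQ hR hΩ hKa
  have h1 := mul_norm_sub_sq_le hn hm hQ hR hΩ hKs hE hKa
  have h2 : 0 < lambdaMin p.R * (p.nu / p.costValue K) :=
    mul_pos (lambdaMin_pos hm hR) (div_pos hν ha)
  have h3 : ‖K - Ks‖ ^ 2 ≤ 0 := by
    by_contra! h
    have := mul_pos h2 h
    linarith
  have h4 : ‖K - Ks‖ ^ 2 = 0 := le_antisymm h3 (by positivity)
  simpa [sub_eq_zero] using h4

end Optimal

lemma isOptimal_iff {K₀ : Matrix (Fin m) (Fin n) ℝ} (hK₀ : K₀ ∈ p.stabilizing)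
    {K : Matrix (Fin m) (Fin n) ℝ} :
    p.IsOptimal K ↔ K ∈ p.stabilizing ∧ ∀ L ∈ p.stabilizing, p.costValue K ≤ p.costValue L := by
  constructor
  · intro h
    have hK : K ∈ p.stabilizing := by
      by_contra hK
      have := h K₀
      rw [cost, cost, if_neg hK, if_pos hK₀] at this
      exact EReal.coe_ne_top _ (top_le_iff.1 this)
    refine ⟨hK, fun L hL => ?_⟩
    have := h L
    rw [cost, cost, if_pos hK, if_pos hL] at this
    exact EReal.coe_le_coe_iff.1 this
  · rintro ⟨hK, h⟩ L
    rw [cost, cost, if_pos hK]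
    split_ifs with hL
    · exact EReal.coe_le_coe_iff.2 (h L hL)
    · exact le_top

/-! ### Comparison of the decay rates -/

/-- The rate `2 μ c²` is dominated by `gradientRate`, since `η ≥ 0` and `c ≤ ν / a`. -/
lemma two_mul_mu_mul_c_sq (hn : 0 < n) (hm : 0 < m) (hQ : p.Q.PosDef) (hR : p.R.PosDef)
    (hΩ : p.Ω.PosDef) {a : ℝ} (ha : 0 < a) (hν : 0 < p.nu) :
    0 < 2 * p.mu a * p.c a ^ 2 ∧ 2 * p.mu a * p.c a ^ 2 ≤ p.gradientRate a := by
  have hq := lambdaMin_pos hn hQ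
  have hr := lambdaMin_pos hm hR
  have hω := lambdaMin_pos hn hΩ
  -- If `X ↦ A X + X Aᵀ` is singular, `normLyapInv` is the norm of the junk inverse `0`; nothing
  -- below uses more than its nonnegativity.
  have hη : 0 ≤ p.eta := by
    have : 0 ≤ normInputMap p.B := norm_nonneg _
    unfold eta
    positivity
  have hs : 0 < √(p.nu * lambdaMin p.R) := Real.sqrt_pos.2 (mul_pos hν hr)
  have hA : 0 ≤ normLyapInv p.A := norm_nonneg _
  have hB := norm2_nonneg p.B
  have hc0 : 0 < p.c a := by unfold c; positivity
  have hc1 : p.c a ≤ p.nu / a := by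
    unfold c
    rw [div_le_div_iff₀ (by positivity) ha]
    have : 0 ≤ p.nu * (2 * a ^ 2 * normLyapInv p.A * norm2 p.B) := by positivity
    linarith
  have hμ0 : 0 < p.mu a := by unfold mu; positivity
  have hμ1 : p.mu a ≤ 2 * lambdaMin p.R * lambdaMin p.Q / a := by
    unfold mu
    refine div_le_div_of_nonneg_left (by positivity) ha ?_
    have : 1 ≤ (1 + a ^ 2 * p.eta) ^ 2 := one_le_pow₀ (le_add_of_nonneg_right (by positivity))
    exact le_mul_of_one_le_right ha.le this
  refine ⟨by positivity, ?_⟩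
  calc 2 * p.mu a * p.c a ^ 2
      ≤ 2 * (2 * lambdaMin p.R * lambdaMin p.Q / a) * (p.nu / a) ^ 2 := by gcongr
    _ = p.gradientRate a := by
        unfold gradientRate
        field_simp
        ring

end Params

/-! ### Global flows of bounded Lipschitz vector fields -/

section Flow

variable {E : Type*} [NormedAddCommGroup E] [NormedSpace ℝ E]

lemma eqOn_Icc_of_lipschitz {V : E → E} {C : NNReal} (hV : LipschitzWith C V) {f g : ℝ → E} {b : ℝ}
    (hf : ∀ t ∈ Set.Icc 0 b, HasDerivWithinAt f (V (f t)) (Set.Icc 0 b) t)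
    (hg : ∀ t ∈ Set.Icc 0 b, HasDerivWithinAt g (V (g t)) (Set.Icc 0 b) t) (h0 : f 0 = g 0) :
    Set.EqOn f g (Set.Icc 0 b) := by
  have hright : ∀ {f : ℝ → E},
      (∀ t ∈ Set.Icc 0 b, HasDerivWithinAt f (V (f t)) (Set.Icc 0 b) t) →
      ∀ t ∈ Set.Ico 0 b, HasDerivWithinAt f (V (f t)) (Set.Ici t) t := fun hf t ht =>
    (hf t ⟨ht.1, ht.2.le⟩).mono_of_mem_nhdsWithin
      (mem_of_superset (Icc_mem_nhdsGE ht.2) (Set.Icc_subset_Icc_left ht.1))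
  exact ODE_solution_unique_of_mem_Icc_right (v := fun _ => V) (s := fun _ => Set.univ)
    (fun _ _ => hV.lipschitzOnWith) (fun t ht => (hf t ht).continuousWithinAt) (hright hf)
    (fun _ _ => Set.mem_univ _) (fun t ht => (hg t ht).continuousWithinAt) (hright hg)
    (fun _ _ => Set.mem_univ _) h0

lemma eqOn_Ici_of_lipschitz {V : E → E} {C : NNReal} (hV : LipschitzWith C V) {f g : ℝ → E}
    (hf : ∀ t, 0 ≤ t → HasDerivWithinAt f (V (f t)) (Set.Ici 0) t)
    (hg : ∀ t, 0 ≤ t → HasDerivWithinAt g (V (g t)) (Set.Ici 0) t) (h0 : f 0 = g 0) :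
    Set.EqOn f g (Set.Ici 0) := fun t ht =>
  eqOn_Icc_of_lipschitz hV (b := t) (fun s hs => (hf s hs.1).mono Set.Icc_subset_Ici_self)
    (fun s hs => (hg s hs.1).mono Set.Icc_subset_Ici_self) h0 ⟨ht, le_rfl⟩

/-- A bounded Lipschitz vector field has forward integral curves for all times: the
Picard–Lindelöf theorem applies on every interval `[0, N]`, and the solutions agree. -/
lemma exists_forward_integralCurve [CompleteSpace E] {V : E → E} {C M : NNReal}
    (hV : LipschitzWith C V) (hM : ∀ x, ‖V x‖ ≤ M) (x₀ : E) :
    ∃ γ : ℝ → E, γ 0 = x₀ ∧ ∀ t, 0 ≤ t → HasDerivWithinAt γ (V (γ t)) (Set.Ici 0) t := by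
  have hex : ∀ N : ℕ, ∃ α : ℝ → E, α 0 = x₀ ∧
      ∀ t ∈ Set.Icc (0 : ℝ) N, HasDerivWithinAt α (V (α t)) (Set.Icc (0 : ℝ) N) t := by
    intro N
    have h : IsPicardLindelof (fun _ => V) (tmin := 0) (tmax := N)
        ⟨0, le_rfl, by positivity⟩ x₀ (M * N) 0 M C :=
      { lipschitzOnWith := fun _ _ => hV.lipschitzOnWith
        continuousOn := fun _ _ => continuousOn_const
        norm_le := fun _ _ x _ => hM x
        mul_max_le := by simp }
    exact h.exists_eq_forall_mem_Icc_hasDerivWithinAt₀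
  choose α hα0 hα using hex
  have hagree : ∀ {N k : ℕ}, N ≤ k → Set.EqOn (α N) (α k) (Set.Icc 0 N) := fun {N k} hNk =>
    eqOn_Icc_of_lipschitz hV (hα N)
      (fun t ht => (hα k t ⟨ht.1, ht.2.trans (by exact_mod_cast hNk)⟩).mono
        (Set.Icc_subset_Icc_right (by exact_mod_cast hNk))) ((hα0 N).trans (hα0 k).symm)
  refine ⟨fun t => α ⌈t⌉₊ t, by simp [hα0], fun t ht => ?_⟩
  set k := ⌈t⌉₊ + 1
  have htk : t < k := by
    have := Nat.le_ceil t
    push_cast [k]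
    linarith
  have heq : ∀ s ∈ Set.Ico (0 : ℝ) k, α ⌈s⌉₊ s = α k s := fun s hs =>
    hagree (Nat.ceil_le.2 hs.2.le) ⟨hs.1, Nat.le_ceil s⟩
  have h1 : HasDerivWithinAt (α k) (V (α k t)) (Set.Ici 0) t :=
    (hα k t ⟨ht, htk.le⟩).mono_of_mem_nhdsWithin
      (mem_of_superset (inter_mem_nhdsWithin _ (Iic_mem_nhds htk)) fun s hs => ⟨hs.1, hs.2⟩)
  rw [← heq t ⟨ht, htk⟩] at h1
  refine h1.congr_of_eventuallyEq ?_ (heq t ⟨ht, htk⟩)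
  filter_upwards [inter_mem_nhdsWithin _ (Iio_mem_nhds htk)] with s hs
  exact heq s ⟨hs.1, hs.2⟩

/-- A `C¹` vector field on an open set can be multiplied by a nonnegative cutoff function, equal to
`1` on a given compact subset, so as to become globally bounded and Lipschitz. -/
lemma exists_cutoff [FiniteDimensional ℝ E] {G : E → E} {S U : Set E} (hS : IsCompact S)
    (hU : IsOpen U) (hSU : S ⊆ U) (hG : ∀ x ∈ U, ContDiffAt ℝ 1 G x) :
    ∃ χ : E → ℝ, (∀ x, 0 ≤ χ x) ∧ (∀ x ∈ S, χ x = 1) ∧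
      ∃ C M : NNReal, LipschitzWith C (fun x => χ x • G x) ∧ ∀ x, ‖χ x • G x‖ ≤ M := by
  obtain ⟨L, hL, hSL, hLU⟩ := exists_compact_between hS hU hSU
  obtain ⟨χ, h1, h0, hχ⟩ := exists_contMDiffMap_one_nhds_of_subset_interior
    (modelWithCornersSelf ℝ E) (n := 1) hS.isClosed hSL
  have hχd : ContDiff ℝ 1 χ := χ.contMDiff.contDiff
  have hχs : Function.support χ ⊆ L := fun x hx => by
    by_contra hxL
    exact hx (h0 x hxL)
  have hsupp : HasCompactSupport fun x => χ x • G x :=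
    HasCompactSupport.smul_right (HasCompactSupport.of_support_subset_isCompact hL hχs)
  have hcd : ContDiff ℝ 1 fun x => χ x • G x := by
    refine contDiff_iff_contDiffAt.2 fun x => ?_
    by_cases hx : x ∈ U
    · exact hχd.contDiffAt.smul (hG x hx)
    · have hxL : x ∈ Lᶜ := fun h => hx (hLU h)
      refine (contDiffAt_const (c := (0 : E))).congr_of_eventuallyEq ?_
      filter_upwards [hL.isClosed.isOpen_compl.mem_nhds hxL] with y hy
      rw [h0 y hy, zero_smul]
  obtain ⟨C, hC⟩ := ContDiff.lipschitzWith_of_hasCompactSupport hsupp hcd one_ne_zero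
  obtain ⟨M, hM⟩ := hcd.continuous.bounded_above_of_compact_support hsupp
  refine ⟨χ, fun x => (hχ x).1, fun x hx => h1.self_of_nhdsSet x hx, C, M.toNNReal, hC, fun x => ?_⟩
  exact (hM x).trans (Real.le_coe_toNNReal M)

end Flow

lemma le_exp_mul_of_deriv_le {φ d : ℝ → ℝ} {ρ : ℝ}
    (hφ : ∀ t, 0 ≤ t → HasDerivWithinAt φ (d t) (Set.Ici 0) t)
    (hd : ∀ t, 0 ≤ t → d t ≤ -ρ * φ t) {t : ℝ} (ht : 0 ≤ t) :
    φ t ≤ Real.exp (-ρ * t) * φ 0 := by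
  have hg : ∀ s, 0 ≤ s → HasDerivWithinAt (fun s => Real.exp (ρ * s) * φ s)
      (Real.exp (ρ * s) * (ρ * φ s + d s)) (Set.Ici 0) s := fun s hs => by
    have h1 : HasDerivAt (fun s => Real.exp (ρ * s)) (Real.exp (ρ * s) * ρ) s := by
      simpa using ((hasDerivAt_id s).const_mul ρ).exp
    have h2 := h1.hasDerivWithinAt.mul (hφ s hs)
    have e : Real.exp (ρ * s) * (ρ * φ s + d s)
      = Real.exp (ρ * s) * ρ * φ s + Real.exp (ρ * s) * d s := by ring
    rw [e]
    exact h2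
  have hanti : AntitoneOn (fun s => Real.exp (ρ * s) * φ s) (Set.Ici 0) := by
    refine antitoneOn_of_hasDerivWithinAt_nonpos (convex_Ici 0)
      (f' := fun s => Real.exp (ρ * s) * (ρ * φ s + d s))
      (fun s hs => (hg s hs).continuousWithinAt)
      (fun s hs => (hg s (interior_subset hs)).mono interior_subset) fun s hs => ?_
    have := hd s (interior_subset hs)
    exact mul_nonpos_of_nonneg_of_nonpos (Real.exp_pos _).le (by linarith)
  have h := hanti (Set.mem_Ici.2 le_rfl) ht ht
  simp only [mul_zero, Real.exp_zero, one_mul] at h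
  calc φ t = Real.exp (-ρ * t) * (Real.exp (ρ * t) * φ t) := by
        rw [← mul_assoc, ← Real.exp_add]
        simp
    _ ≤ Real.exp (-ρ * t) * φ 0 := mul_le_mul_of_nonneg_left h (Real.exp_pos _).le

namespace Params

variable {n m : ℕ} {p : Params n m}

/-! ### The gradient flow of the cost -/

/-- The derivative of the cost along a curve which moves with velocity `-s ∇f`. -/
lemma hasDerivWithinAt_costValue (hn : 0 < n) (hm : 0 < m) (hQ : p.Q.PosDef) (hR : p.R.PosDef)
    (hΩ : p.Ω.PosDef) {γ : ℝ → Matrix (Fin m) (Fin n) ℝ} {t s : ℝ} {T : Set ℝ}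
    (hγ : γ t ∈ p.stabilizing) (hd : HasDerivWithinAt γ (s • -p.grad (γ t)) T t) :
    HasDerivWithinAt (fun t => p.costValue (γ t)) (-(s * ‖p.grad (γ t)‖ ^ 2)) T t := by
  have h := (hasFDerivAt_costValue hn hm hQ hR hΩ hγ).comp_hasDerivWithinAt t hd
  have e : traceForm (p.grad (γ t)) (s • -p.grad (γ t)) = -(s * ‖p.grad (γ t)‖ ^ 2) := by
    rw [map_smul, map_neg, traceForm_apply, ← frobenius_sq, smul_eq_mul, mul_neg]
  rw [e] at h
  exact h

lemma isGradientFlow_iff (hn : 0 < n) (hm : 0 < m) (hQ : p.Q.PosDef) (hR : p.R.PosDef)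
    (hΩ : p.Ω.PosDef) {γ : ℝ → Matrix (Fin m) (Fin n) ℝ} :
    p.IsGradientFlow γ ↔ ∀ t, 0 ≤ t → γ t ∈ p.stabilizing ∧
      HasDerivWithinAt γ (-p.grad (γ t)) (Set.Ici 0) t := by
  refine forall₂_congr fun t _ => and_congr_right fun hγ => ?_
  constructor
  · rintro ⟨G, hG, hd⟩
    rw [hasMatrixGradientAt_costValue_iff hn hm hQ hR hΩ hγ] at hG
    rw [← hG]
    exact hd
  · exact fun hd => ⟨_, (hasMatrixGradientAt_costValue_iff hn hm hQ hR hΩ hγ).2 rfl, hd⟩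

lemma IsGradientFlow.mem_sublevel (hn : 0 < n) (hm : 0 < m) (hQ : p.Q.PosDef) (hR : p.R.PosDef)
    (hΩ : p.Ω.PosDef) {γ : ℝ → Matrix (Fin m) (Fin n) ℝ} (hγ : p.IsGradientFlow γ) {t : ℝ}
    (ht : 0 ≤ t) : γ t ∈ p.sublevel (p.costValue (γ 0)) := by
  have h := (isGradientFlow_iff hn hm hQ hR hΩ).1 hγ
  refine ⟨(h t ht).1, ?_⟩
  have := le_exp_mul_of_deriv_le (ρ := 0) (fun s hs => hasDerivWithinAt_costValue hn hm hQ hR hΩ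
    (s := 1) (h s hs).1 (by rw [one_smul]; exact (h s hs).2))
    (fun s hs => by rw [neg_zero, zero_mul, one_mul]; exact neg_nonpos.2 (sq_nonneg _)) ht
  simpa using this

/-- A curve which follows a nonnegative multiple of the negative gradient does not leave the
sublevel set of its starting point: by continuity it stays stabilizing for a short time after any
time in the sublevel set, and the cost decreases during that time. -/
lemma mem_sublevel_of_hasDerivWithinAt (hn : 0 < n) (hm : 0 < m) (hQ : p.Q.PosDef)
    (hR : p.R.PosDef) (hΩ : p.Ω.PosDef) {χ : Matrix (Fin m) (Fin n) ℝ → ℝ} (hχ : ∀ K, 0 ≤ χ K)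
    {γ : ℝ → Matrix (Fin m) (Fin n) ℝ} {a : ℝ} (h0 : γ 0 ∈ p.sublevel a)
    (hd : ∀ t, 0 ≤ t → HasDerivWithinAt γ (χ (γ t) • -p.grad (γ t)) (Set.Ici 0) t) {t : ℝ}
    (ht : 0 ≤ t) : γ t ∈ p.sublevel a := by
  have hc : ContinuousOn γ (Set.Ici 0) := fun s hs => (hd s hs).continuousWithinAt
  have hclosed : IsClosed ({s | γ s ∈ p.sublevel a} ∩ Set.Icc 0 t) := by
    rw [Set.inter_comm]
    exact (hc.mono Set.Icc_subset_Ici_self).preimage_isClosed_of_isClosed isClosed_Icc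
      (isCompact_sublevel hn hm hQ hR hΩ a).isClosed
  refine hclosed.Icc_subset_of_forall_mem_nhdsWithin h0 (fun x hx => ?_) ⟨ht, le_rfl⟩
  obtain ⟨hxa, hx0, hxt⟩ := hx
  have hnear : ∀ᶠ s in 𝓝[≥] x, γ s ∈ p.stabilizing :=
    ((hc x hx0).mono (Set.Ici_subset_Ici.2 hx0)).eventually
      ((isOpen_stabilizing hn hm hQ hR hΩ).mem_nhds hxa.1)
  obtain ⟨u, hxu, hu⟩ := (mem_nhdsGE_iff_exists_Ico_subset).1 hnear
  filter_upwards [Ioo_mem_nhdsGT hxu] with y hy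
  have hst : ∀ s ∈ Set.Icc x y, γ s ∈ p.stabilizing := fun s hs =>
    hu ⟨hs.1, hs.2.trans_lt hy.2⟩
  have hder : ∀ s ∈ Set.Icc x y, HasDerivWithinAt (fun s => p.costValue (γ s))
      (-(χ (γ s) * ‖p.grad (γ s)‖ ^ 2)) (Set.Icc x y) s := fun s hs =>
    hasDerivWithinAt_costValue hn hm hQ hR hΩ (hst s hs)
      ((hd s (hx0.trans hs.1)).mono fun r hr => hx0.trans hr.1)
  have hanti : AntitoneOn (fun s => p.costValue (γ s)) (Set.Icc x y) :=
    antitoneOn_of_hasDerivWithinAt_nonpos (convex_Icc x y)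
      (fun s hs => (hder s hs).continuousWithinAt)
      (fun s hs => (hder s (interior_subset hs)).mono interior_subset)
      fun s hs => neg_nonpos.2 (mul_nonneg (hχ _) (sq_nonneg _))
  have hxy : x ≤ y := hy.1.le
  exact ⟨hst y ⟨hxy, le_rfl⟩,
    (hanti ⟨le_rfl, hxy⟩ ⟨hxy, le_rfl⟩ hxy).trans hxa.2⟩

/-- Existence and uniqueness of the gradient flow, by cutting off the gradient field outside the
compact sublevel set of the starting point. -/
lemma existsUnique_isGradientFlow (hn : 0 < n) (hm : 0 < m) (hQ : p.Q.PosDef) (hR : p.R.PosDef)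
    (hΩ : p.Ω.PosDef) {K₀ : Matrix (Fin m) (Fin n) ℝ} (hK₀ : K₀ ∈ p.stabilizing) :
    (∃ K : ℝ → Matrix (Fin m) (Fin n) ℝ, p.IsGradientFlow K ∧ K 0 = K₀) ∧
      ∀ K L : ℝ → Matrix (Fin m) (Fin n) ℝ, p.IsGradientFlow K → K 0 = K₀ →
        p.IsGradientFlow L → L 0 = K₀ → Set.EqOn K L (Set.Ici 0) := by
  set a := p.costValue K₀
  obtain ⟨χ, hχ0, hχ1, C, M, hC, hM⟩ := exists_cutoff (G := fun K => -p.grad K)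
    (isCompact_sublevel hn hm hQ hR hΩ a) (isOpen_stabilizing hn hm hQ hR hΩ)
    (fun K hK => hK.1) (fun K hK => (contDiffAt_grad hn hm hQ hR hΩ hK).neg)
  constructor
  · obtain ⟨γ, hγ0, hγ⟩ := exists_forward_integralCurve hC hM K₀
    have hmem : ∀ t, 0 ≤ t → γ t ∈ p.sublevel a := fun t ht =>
      mem_sublevel_of_hasDerivWithinAt hn hm hQ hR hΩ hχ0 (by rw [hγ0]; exact ⟨hK₀, le_rfl⟩) hγ ht
    refine ⟨γ, (isGradientFlow_iff hn hm hQ hR hΩ).2 fun t ht => ⟨(hmem t ht).1, ?_⟩, hγ0⟩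
    have := hγ t ht
    rwa [hχ1 _ (hmem t ht), one_smul] at this
  · intro K L hK hK0 hL hL0
    have hcut : ∀ {J : ℝ → Matrix (Fin m) (Fin n) ℝ}, p.IsGradientFlow J → J 0 = K₀ →
        ∀ t, 0 ≤ t → HasDerivWithinAt J (χ (J t) • -p.grad (J t)) (Set.Ici 0) t := by
      intro J hJ hJ0 t ht
      have hmem := hJ.mem_sublevel hn hm hQ hR hΩ ht
      rw [hJ0] at hmem
      rw [hχ1 _ hmem, one_smul]
      exact ((isGradientFlow_iff hn hm hQ hR hΩ).1 hJ t ht).2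
    exact eqOn_Ici_of_lipschitz hC (hcut hK hK0) (hcut hL hL0) (hK0.trans hL0.symm)

/-- Along the gradient flow the Polyak–Łojasiewicz inequality turns into exponential decay. -/
lemma IsGradientFlow.exponential_decay (hn : 0 < n) (hm : 0 < m) (hQ : p.Q.PosDef)
    (hR : p.R.PosDef) (hΩ : p.Ω.PosDef) {Ks : Matrix (Fin m) (Fin n) ℝ} (hKs : Ks ∈ p.stabilizing)
    (hmin : ∀ L ∈ p.stabilizing, p.costValue Ks ≤ p.costValue L)
    {γ : ℝ → Matrix (Fin m) (Fin n) ℝ} (hγ : p.IsGradientFlow γ) {a ρ : ℝ}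
    (ha : p.costValue (γ 0) ≤ a) (hρ : ρ ≤ p.gradientRate a) {t : ℝ} (ht : 0 ≤ t) :
    p.costValue (γ t) - p.costValue Ks
        ≤ Real.exp (-ρ * t) * (p.costValue (γ 0) - p.costValue Ks) ∧
      ‖γ t - Ks‖ ^ 2 ≤ p.b a * Real.exp (-ρ * t) * ‖γ 0 - Ks‖ ^ 2 := by
  have h := (isGradientFlow_iff hn hm hQ hR hΩ).1 hγ
  have hmem : ∀ s, 0 ≤ s → γ s ∈ p.sublevel a := fun s hs =>
    ⟨(h s hs).1, (hγ.mem_sublevel hn hm hQ hR hΩ hs).2.trans ha⟩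
  have hKsa : Ks ∈ p.sublevel a := ⟨hKs, (hmin _ (h 0 le_rfl).1).trans ha⟩
  have hdecay : p.costValue (γ t) - p.costValue Ks
      ≤ Real.exp (-ρ * t) * (p.costValue (γ 0) - p.costValue Ks) := by
    refine le_exp_mul_of_deriv_le (φ := fun t => p.costValue (γ t) - p.costValue Ks)
      (fun s hs => (hasDerivWithinAt_costValue hn hm hQ hR hΩ (s := 1) (h s hs).1
        (by rw [one_smul]; exact (h s hs).2)).sub_const _) (fun s hs => ?_) ht
    have h1 := gradientRate_mul_le hn hm hQ hR hΩ (hmem s hs) hKsa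
    have h2 := mul_le_mul_of_nonneg_right hρ (sub_nonneg.2 (hmin _ (h s hs).1))
    linarith
  refine ⟨hdecay, ?_⟩
  have hE := gradFactor_eq_zero hn hm hQ hR hΩ hKs hmin
  have hl := mul_norm_sub_sq_le hn hm hQ hR hΩ hKs hE (hmem t ht)
  have hu := costValue_sub_le_mul_norm_sq hn hm hQ hR hΩ hKs hE (hmem 0 le_rfl)
  obtain ⟨ha0, hν⟩ := level_pos_and_nu_pos hn hm hQ hR hΩ hKsa
  have hq := lambdaMin_pos hn hQ
  have hr := lambdaMin_pos hm hR
  have h3 : lambdaMin p.R * (p.nu / a) * ‖γ t - Ks‖ ^ 2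
      ≤ Real.exp (-ρ * t) * (norm2 p.R * (a / lambdaMin p.Q) * ‖γ 0 - Ks‖ ^ 2) :=
    (hl.trans hdecay).trans (mul_le_mul_of_nonneg_left hu (Real.exp_pos _).le)
  have h4 : 0 < lambdaMin p.R * (p.nu / a) := by positivity
  refine le_of_mul_le_mul_left (h3.trans (le_of_eq ?_)) h4
  unfold b
  field_simp

end Params

end LQR

end

theorem theorem1 {n m : ℕ} (hn : 0 < n) (hm : 0 < m) (p : LQR.Params n m)
    (hQ : p.Q.PosDef) (hR : p.R.PosDef) (hΩ : p.Ω.PosDef)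
    (K₀ : Matrix (Fin m) (Fin n) ℝ) (hK₀ : K₀ ∈ p.stabilizing) :
    ∃ Kstar : Matrix (Fin m) (Fin n) ℝ,
      -- there is exactly one optimal gain
      p.IsOptimal Kstar ∧ (∀ K, p.IsOptimal K → K = Kstar) ∧
      -- the gradient flow started at `K₀` has exactly one solution on `[0, ∞)`
      (∃ K : ℝ → Matrix (Fin m) (Fin n) ℝ, p.IsGradientFlow K ∧ K 0 = K₀) ∧
      (∀ K L : ℝ → Matrix (Fin m) (Fin n) ℝ, p.IsGradientFlow K → K 0 = K₀ →
        p.IsGradientFlow L → L 0 = K₀ → Set.EqOn K L (Set.Ici 0)) ∧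
      -- exponential convergence, for `K₀` in the sublevel set of level `a`
      ∀ a : ℝ, p.cost K₀ ≤ (a : EReal) →
        ∃ ρ : ℝ, 0 < ρ ∧ (IsUnit (LQR.lyap p.A) → ρ = 2 * p.mu a * p.c a ^ 2) ∧
          ∀ K : ℝ → Matrix (Fin m) (Fin n) ℝ, p.IsGradientFlow K → K 0 = K₀ →
            ∀ t : ℝ, 0 ≤ t →
              p.costValue (K t) - p.costValue Kstar
                  ≤ Real.exp (-ρ * t) * (p.costValue K₀ - p.costValue Kstar) ∧
              ‖K t - Kstar‖ ^ 2 ≤ p.b a * Real.exp (-ρ * t) * ‖K₀ - Kstar‖ ^ 2 := by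
  open LQR.Params in
  obtain ⟨Ks, hKs, hmin⟩ := exists_minimizer hn hm hQ hR hΩ hK₀
  obtain ⟨hex, huniq⟩ := existsUnique_isGradientFlow hn hm hQ hR hΩ hK₀
  refine ⟨Ks, (isOptimal_iff hK₀).2 ⟨hKs, hmin⟩, fun K hK => ?_, hex, huniq, fun a ha => ?_⟩
  · obtain ⟨hKst, hKmin⟩ := (isOptimal_iff hK₀).1 hK
    exact eq_of_costValue_le hn hm hQ hR hΩ hKs (gradFactor_eq_zero hn hm hQ hR hΩ hKs hmin) hKst
      (hKmin Ks hKs)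
  have ha' : p.costValue K₀ ≤ a := by
    rw [LQR.Params.cost, if_pos hK₀] at ha
    exact EReal.coe_le_coe_iff.1 ha
  obtain ⟨ha0, hν⟩ := level_pos_and_nu_pos hn hm hQ hR hΩ (show K₀ ∈ p.sublevel a from ⟨hK₀, ha'⟩)
  obtain ⟨hρ, hle⟩ := two_mul_mu_mul_c_sq hn hm hQ hR hΩ ha0 hν
  refine ⟨2 * p.mu a * p.c a ^ 2, hρ, fun _ => rfl, fun K hK hK0 t ht => ?_⟩
  rw [← hK0] at ha' ⊢
  exact hK.exponential_decay hn hm hQ hR hΩ hKs hmin ha' hle ht
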